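/- **Setting.** Let $c_1,\dots,c_n$ ($n\ge 1$) be the canonical annihilation operators on the $2^n$-dimensional fermionic Fock space, $\{c_i,c_j^\dagger\}=\delta_{ij}$, $\{c_i,c_j\}=0$. Let $M$ be a real symmetric $n\times n$ matrix with eigenvalues $\varepsilon_1,\dots,\varepsilon_n$, let $H=\sum_{i,j}M_{ij}c_i^\dagger c_j$, let $\beta\in\mathbb R$ be the inverse temperature and $\sigma_\beta=e^{-\beta H}/\operatorname{Tr}e^{-\beta H}$. Let $q:\mathbb R\to\mathbb R$ be even and put $\hat f(\nu)=q(\nu)e^{-\beta\nu/4}$. For an operator $A$ let $A_\nu=\sum_{E-E'=\nu}P_EAP_{E'}$, where $E,E'$ run over the spectrum of $H$ and $P_E$ is the projector onto the eigenspace of $E$; $A_\nu$ is non-zero only if $\nu$ lies in the finite set $B_H$ of differences of eigenvalues of $H$. With the $2n$ jump operators $A^a\in\{c_1,\dots,c_n,c_1^\dagger,\dots,c_n^\dagger\}$ put $$L_a=\sum_{\nu\in B_H}\hat f(\nu)A^a_\nu,\qquad G=\frac i2\sum_a\sum_{\nu\in B_H}\tanh\Big(\frac{\beta\nu}4\Big)(L_a^\dagger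 L_a)_\nu .$$ The Gibbs-sampler Lindbladian is $\mathcal L^\dagger[\rho]=-i[G,\rho]+\sum_a\big(L_a\rho L_a^\dagger-\tfrac12\{L_a^\dagger L_a,\rho\}\big)$ (the Hilbert–Schmidt adjoint of the Heisenberg-picture Lindbladian $\mathcal L[O]=i[G,O]+\sum_a(L_a^\dagger OL_a-\tfrac12\{L_a^\dagger L_a,O\})$), and its mixing time is $$t_{\rm mix}(\epsilon)=\inf\{t\ge 0:\ \|e^{t\mathcal L^\dagger}[\rho]-\sigma_\beta\|_{\rm Tr}\le\epsilon\ \text{ for all states }\rho\},\qquad \|A\|_{\rm Tr}=\operatorname{Tr}\sqrt{A^\dagger A},$$ with $\inf\emptyset=\infty$. Let $\Delta_0=2\min_i q(\varepsilon_i)^2\cosh(\beta\varepsilon_i/2)$. **Proposition (rapid mixing of free fermions).** 1. If $\Delta_0>0$, then for every $\epsilon>0$ $$t_{\rm mix}(\epsilon)\le\frac{2}{\Delta_0}\log\frac{8n}{\epsilon},$$ where the right-hand side is read as $0$ if $\epsilon>8n$. 2. Mixing is logarithmic in $n$, uniformly over all free fermionic systems with a bounded single-particle Hamiltonian: for every $C$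 such that $q$ is continuous and has no zero on $[-C,C]$ there is a constant $\kappa>0$, depending only on $\beta$, $q$ and $C$, such that for every $n\ge1$ and every real symmetric $n\times n$ matrix $M$ with operator norm $\|M\|\le C$ one has $\Delta_0\ge\kappa$, and hence $t_{\rm mix}(\epsilon)\le\frac2\kappa\log\frac{8n}{\epsilon}$ for every $\epsilon>0$ (again read as $0$ if $\epsilon>8n$). -/

import Mathlib

open scoped Matrix ENNReal NNReal ComplexOrder

noncomputable section

namespace GibbsSampler

variable {ι : Type*} [Fintype ι] [DecidableEq ι]

/-! ### States, Gibbs state, trace norm -/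

/-- A density matrix: positive semidefinite with trace one. -/
def IsState (ρ : Matrix ι ι ℂ) : Prop := ρ.PosSemidef ∧ ρ.trace = 1

/-- The Gibbs state `e^{-βH} / Tr e^{-βH}` of the Hamiltonian `H` at inverse temperature `β`. -/
def gibbsState (β : ℝ) (H : Matrix ι ι ℂ) : Matrix ι ι ℂ :=
  (Matrix.trace (NormedSpace.exp ((-β : ℂ) • H)))⁻¹ • NormedSpace.exp ((-β : ℂ) • H)

/-- The trace norm `Tr √(A† A)`. -/
def traceNorm (A : Matrix ι ι ℂ) : ℝ := (Matrix.trace (cfc Real.sqrt (Aᴴ * A))).re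

/-! ### Bohr frequencies and filtered jump operators -/

/-- The set of energies `spec(H)` of the Hamiltonian `H`. -/
def energies (H : Matrix ι ι ℂ) : Finset ℝ := (Matrix.finite_real_spectrum (A := H)).toFinset

/-- The orthogonal projector onto the eigenspace of the Hermitian matrix `H` with eigenvalue `E`,
as the spectral projection `1_{E}(H)`. -/
def energyProj (H : Matrix ι ι ℂ) (E : ℝ) : Matrix ι ι ℂ :=
  cfc (fun x : ℝ => if x = E then (1 : ℝ) else 0) H

/-- The set of Bohr frequencies: all energy differences of `H`. -/
def bohrFrequencies (H : Matrix ι ι ℂ) : Finset ℝ :=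
  (energies H ×ˢ energies H).image fun p => p.1 - p.2

/-- The Bohr component `A_ν = ∑_{E - E' = ν} P_E A P_{E'}`. -/
def bohrComponent (H A : Matrix ι ι ℂ) (ν : ℝ) : Matrix ι ι ℂ :=
  ∑ p ∈ (energies H ×ˢ energies H).filter (fun p => p.1 - p.2 = ν),
    energyProj H p.1 * A * energyProj H p.2

/-- The filtered operator `f(ad_H) A = ∑_ν f(ν) A_ν`. -/
def filteredJump (f : ℝ → ℝ) (H A : Matrix ι ι ℂ) : Matrix ι ι ℂ :=
  ∑ ν ∈ bohrFrequencies H, (f ν : ℂ) • bohrComponent H A ν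

/-! ### Lindbladians -/

/-- The Heisenberg-picture Lindbladian with coherent term `G` and Lindblad operators `L a`:
`O ↦ i[G, O] + ∑ₐ (Lₐ† O Lₐ - ½ {Lₐ† Lₐ, O})`. -/
def heisenbergLindbladian {𝒜 : Type*} [Fintype 𝒜] (G : Matrix ι ι ℂ) (L : 𝒜 → Matrix ι ι ℂ) :
    Matrix ι ι ℂ →ₗ[ℂ] Matrix ι ι ℂ where
  toFun O := Complex.I • (G * O - O * G) +
    ∑ a, ((L a)ᴴ * O * L a - (1 / 2 : ℂ) • ((L a)ᴴ * L a * O + O * ((L a)ᴴ * L a)))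
  map_add' X Y := by
    rw [add_add_add_comm, ← Finset.sum_add_distrib, ← smul_add]
    congr 1
    · congr 1; noncomm_ring
    · refine Finset.sum_congr rfl fun a _ => ?_
      rw [sub_add_sub_comm, ← smul_add]
      congr 1
      · noncomm_ring
      · congr 1; noncomm_ring
  map_smul' z X := by
    simp only [Matrix.mul_smul, Matrix.smul_mul, RingHom.id_apply, smul_add, Finset.smul_sum,
      smul_sub, smul_comm z]

/-- The Schrödinger-picture Lindbladian `𝓛†` with coherent term `G` and Lindblad operators `L a`:
`ρ ↦ -i[G, ρ] + ∑ₐ (Lₐ ρ Lₐ† - ½ {Lₐ† Lₐ, ρ})`. -/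
def schrodingerLindbladian {𝒜 : Type*} [Fintype 𝒜] (G : Matrix ι ι ℂ) (L : 𝒜 → Matrix ι ι ℂ) :
    Matrix ι ι ℂ →ₗ[ℂ] Matrix ι ι ℂ where
  toFun ρ := -(Complex.I • (G * ρ - ρ * G)) +
    ∑ a, (L a * ρ * (L a)ᴴ - (1 / 2 : ℂ) • ((L a)ᴴ * L a * ρ + ρ * ((L a)ᴴ * L a)))
  map_add' X Y := by
    rw [add_add_add_comm, ← Finset.sum_add_distrib, ← neg_add, ← smul_add]
    congr 1
    · congr 2; noncomm_ring
    · refine Finset.sum_congr rfl fun a _ => ?_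
      rw [sub_add_sub_comm, ← smul_add]
      congr 1
      · noncomm_ring
      · congr 1; noncomm_ring
  map_smul' z X := by
    simp only [Matrix.mul_smul, Matrix.smul_mul, RingHom.id_apply, smul_add, Finset.smul_sum,
      smul_sub, smul_comm z, smul_neg]

/-- The Schrödinger-picture Lindbladian is the adjoint of the Heisenberg-picture one with respect
to the Hilbert–Schmidt inner product `⟨A, B⟩ = Tr(A† B)`. -/
theorem trace_conjTranspose_mul_schrodingerLindbladian {𝒜 : Type*} [Fintype 𝒜]
    {G : Matrix ι ι ℂ} (hG : G.IsHermitian) (L : 𝒜 → Matrix ι ι ℂ) (O ρ : Matrix ι ι ℂ) :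
    Matrix.trace (Oᴴ * schrodingerLindbladian G L ρ) =
      Matrix.trace ((heisenbergLindbladian G L O)ᴴ * ρ) := by
  have h1 : Matrix.trace (Oᴴ * (ρ * G)) = Matrix.trace (G * Oᴴ * ρ) := by
    rw [← Matrix.mul_assoc, Matrix.trace_mul_comm, ← Matrix.mul_assoc]
  have h2 : ∀ a, Matrix.trace (Oᴴ * (L a * ρ * (L a)ᴴ)) =
      Matrix.trace ((L a)ᴴ * (Oᴴ * L a) * ρ) := fun a => by
    rw [← Matrix.mul_assoc, Matrix.trace_mul_comm]
    simp only [Matrix.mul_assoc]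
  have h3 : ∀ a, Matrix.trace (Oᴴ * (ρ * ((L a)ᴴ * L a))) =
      Matrix.trace ((L a)ᴴ * L a * Oᴴ * ρ) := fun a => by
    rw [← Matrix.mul_assoc, Matrix.trace_mul_comm, ← Matrix.mul_assoc]
  simp only [schrodingerLindbladian, heisenbergLindbladian, LinearMap.coe_mk, AddHom.coe_mk,
    Matrix.conjTranspose_add, Matrix.conjTranspose_sub, Matrix.conjTranspose_smul,
    Matrix.conjTranspose_mul, Matrix.conjTranspose_sum, Matrix.conjTranspose_conjTranspose,
    hG.eq, mul_add, add_mul, mul_sub, sub_mul, Finset.mul_sum, Finset.sum_mul, Matrix.trace_add,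
    Matrix.trace_sub, Matrix.trace_sum, Matrix.mul_smul, Matrix.smul_mul, Matrix.trace_smul,
    mul_neg, Matrix.trace_neg, h1, h2, h3]
  simp [Matrix.mul_assoc]

/-- The coherent term `G = (i/2) ∑ₐ ∑_ν tanh(βν/4) (Lₐ† Lₐ)_ν`. -/
def coherentTerm {𝒜 : Type*} [Fintype 𝒜] (β : ℝ) (H : Matrix ι ι ℂ) (L : 𝒜 → Matrix ι ι ℂ) :
    Matrix ι ι ℂ :=
  (Complex.I / 2) • ∑ a, ∑ ν ∈ bohrFrequencies H,
    (Real.tanh (β * ν / 4) : ℂ) • bohrComponent H ((L a)ᴴ * L a) ν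

/-- The filter function `f̂(ν) = q(ν) e^{-βν/4}`. -/
def filterFunction (β : ℝ) (q : ℝ → ℝ) (ν : ℝ) : ℝ := q ν * Real.exp (-(β * ν) / 4)

/-- The generator `𝓛†` (Schrödinger picture) of the Gibbs sampler for the Hamiltonian `H` at
inverse temperature `β` with jump operators `A a`, all filtered by `f̂(ν) = q(ν) e^{-βν/4}`. -/
def gibbsSampler {𝒜 : Type*} [Fintype 𝒜] (β : ℝ) (q : ℝ → ℝ) (H : Matrix ι ι ℂ)
    (A : 𝒜 → Matrix ι ι ℂ) : Matrix ι ι ℂ →ₗ[ℂ] Matrix ι ι ℂ :=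
  schrodingerLindbladian
    (coherentTerm β H fun a => filteredJump (filterFunction β q) H (A a))
    (fun a => filteredJump (filterFunction β q) H (A a))

/-! ### Mixing time -/

open scoped Matrix.Norms.L2Operator in
/-- The time evolution `e^{t𝓛}[ρ]` generated by a linear map `𝓛` on matrices. The exponential is
that of the algebra of (continuous) linear maps on the finite-dimensional space of matrices. -/
def evolution (𝓛 : Matrix ι ι ℂ →ₗ[ℂ] Matrix ι ι ℂ) (t : ℝ) (ρ : Matrix ι ι ℂ) :
    Matrix ι ι ℂ :=
  (NormedSpace.exp ((t : ℂ) • LinearMap.toContinuousLinearMap 𝓛) :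
    Matrix ι ι ℂ →L[ℂ] Matrix ι ι ℂ) ρ

/-- The mixing time: the infimum of all times `t ≥ 0` such that `‖e^{t𝓛}[ρ] - σ‖_Tr ≤ ε` for all
states `ρ`. It is `∞` if there is no such time. -/
def mixingTime (𝓛 : Matrix ι ι ℂ →ₗ[ℂ] Matrix ι ι ℂ) (σ : Matrix ι ι ℂ) (ε : ℝ) : ℝ≥0∞ :=
  ⨅ (t : ℝ≥0) (_ : ∀ ρ, IsState ρ → traceNorm (evolution 𝓛 t ρ - σ) ≤ ε), (t : ℝ≥0∞)

/-! ### Free fermions -/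

/-- The annihilation operator `c_i` on the fermionic Fock space of `n` modes, in the occupation
number basis: the basis vector `|S⟩` is the one in which exactly the modes in `S` are occupied, and
`c_i |S⟩ = (-1)^#{j ∈ S | j < i} |S \ {i}⟩` if `i ∈ S`, and `c_i |S⟩ = 0` otherwise. -/
def annihilation {n : ℕ} (i : Fin n) : Matrix (Finset (Fin n)) (Finset (Fin n)) ℂ :=
  Matrix.of fun T S => if i ∈ S ∧ T = S.erase i then (-1) ^ (S.filter (· < i)).card else 0

/-- The creation operator `c_i†`. -/
def creation {n : ℕ} (i : Fin n) : Matrix (Finset (Fin n)) (Finset (Fin n)) ℂ :=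
  (annihilation i)ᴴ

/-- The free fermionic Hamiltonian `H = ∑_{ij} M_{ij} c_i† c_j`. -/
def freeHamiltonian {n : ℕ} (M : Matrix (Fin n) (Fin n) ℝ) :
    Matrix (Finset (Fin n)) (Finset (Fin n)) ℂ :=
  ∑ i, ∑ j, (M i j : ℂ) • (creation i * annihilation j)

/-- The jump operators `c_i` and `c_i†`. -/
def fermionicJumps {n : ℕ} : Fin n ⊕ Fin n → Matrix (Finset (Fin n)) (Finset (Fin n)) ℂ :=
  Sum.elim annihilation creation

/-- The Gibbs-sampler Lindbladian (Schrödinger picture) of the free fermionic Hamiltonian. -/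
def freeFermionSampler {n : ℕ} (β : ℝ) (q : ℝ → ℝ) (M : Matrix (Fin n) (Fin n) ℝ) :
    Matrix (Finset (Fin n)) (Finset (Fin n)) ℂ →ₗ[ℂ]
      Matrix (Finset (Fin n)) (Finset (Fin n)) ℂ :=
  gibbsSampler β q (freeHamiltonian M) fermionicJumps

/-- The mixing time of the free fermionic Gibbs sampler to the Gibbs state. -/
def freeFermionMixingTime {n : ℕ} (β : ℝ) (q : ℝ → ℝ) (M : Matrix (Fin n) (Fin n) ℝ) (ε : ℝ) :
    ℝ≥0∞ :=
  mixingTime (freeFermionSampler β q M) (gibbsState β (freeHamiltonian M)) ε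

/-- `Δ₀ = 2 min_i q(ε_i)² cosh(β ε_i / 2)`, where `ε_i` are the eigenvalues of the real symmetric
matrix `M`. -/
def freeGap {n : ℕ} (β : ℝ) (q : ℝ → ℝ) {M : Matrix (Fin n) (Fin n) ℝ} (hM : M.IsHermitian) : ℝ :=
  2 * ⨅ i, q (hM.eigenvalues i) ^ 2 * Real.cosh (β * hM.eigenvalues i / 2)

end GibbsSampler

end

/-!
The sampler of a free fermionic Hamiltonian decouples into `n` commuting single-mode relaxation
processes, each of which can be solved explicitly.

Diagonalise `M = U diag(ε) Uᵀ` with `U` orthogonal, and let `dₖ = ∑ᵢ Uᵢₖ cᵢ` be the normal modes.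
They satisfy the canonical anticommutation relations, and `[H, dₖ] = -εₖ dₖ`, so that `dₖ` and
`dₖ†` have the single Bohr frequencies `-εₖ` and `εₖ` (`filteredJump_of_commutator`). The rotation
by `U` drops out of the sum over jumps. Moreover `∑ₐ Lₐ† Lₐ` is a combination of the `dₖ† dₖ` and
`dₖ dₖ†`, hence commutes with `H`, and the coherent term vanishes because `tanh 0 = 0`. Therefore
the generator is the sum over `k` of the damping of the mode `dₖ`, with loss rate
`q(εₖ)² e^{βεₖ/2}` and gain rate `q(εₖ)² e^{-βεₖ/2}` (`freeFermionSampler_eq_sum`).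

For one mode `d`, put `Φ(X) = d X d†` and `Φ'(X) = d† X d`. The damping generator lies in the
algebra generated by `Φ` and `Φ'`. In that algebra the dephasing map `D` and the map `E` resetting
the mode to its thermal occupation are idempotents with `D E = E D = E`, and the generator is
`-γ (D - E) - (γ / 2) (1 - D)`. Its semigroup is `E + s² (D - E) + s (1 - D)` with
`s = e^{-γt/2}`, a mixture of two amplitude damping channels, at distance at most `4 s` from `E`. Relative signs drop
out of the sandwich maps `Φ`, `Φ'`, so those of different modes commute, and the full semigroup is
the product of the single-mode ones (`evolution_sum_modeGenerator`). Since all factors are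
positive and trace preserving, telescoping the product costs at most `4 n e^{-Δ₀t/2}` in trace
norm (`traceBounded_prod_sub_prod`).

It remains to see that resetting all modes produces the Gibbs state (`eq_gibbsState`). The
resulting state `Y` is fixed by each reset, so it satisfies `dₖ Y = e^{-βεₖ} Y dₖ`. Hence
`e^{βH} Y` commutes with all creation and annihilation operators and is a scalar by irreducibility of the
Fock representation.

The uniform bound follows as `|εₖ| ≤ ‖M‖ ≤ C`, `cosh ≥ 1`, and `q²` has a positive minimum on
`[-C, C]`.
-/

set_option linter.unusedSectionVars false

noncomputable section

namespace GibbsSampler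

variable {ι : Type*} [Fintype ι] [DecidableEq ι]

/-! ### Bounding the trace norm -/

theorem continuousOn_spectrum (H : Matrix ι ι ℂ) (f : ℝ → ℝ) : ContinuousOn f (spectrum ℝ H) :=
  (Matrix.finite_real_spectrum (A := H)).continuousOn f

theorem _root_.Matrix.PosSemidef.trace_mul_nonneg {A B : Matrix ι ι ℂ} (hA : A.PosSemidef)
    (hB : B.PosSemidef) : 0 ≤ (A * B).trace := by
  obtain ⟨C, hC⟩ : ∃ C : Matrix ι ι ℂ, B = Cᴴ * C := by
    open scoped MatrixOrder Matrix.Norms.L2Operator in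
    exact CStarAlgebra.nonneg_iff_eq_star_mul_self.mp (Matrix.nonneg_iff_posSemidef.mpr hB)
  rw [hC, ← Matrix.mul_assoc, Matrix.trace_mul_comm, ← Matrix.mul_assoc]
  exact (hA.mul_mul_conjTranspose_same C).trace_nonneg

/-- The trace norm of a difference of positive semidefinite matrices is at most the sum of their
traces: `|X| = sgn(X) X`, and `-1 ≤ sgn(X) ≤ 1`. -/
theorem traceNorm_sub_le {A B : Matrix ι ι ℂ} (hA : A.PosSemidef) (hB : B.PosSemidef) :
    traceNorm (A - B) ≤ A.trace.re + B.trace.re := by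
  have hX : (A - B).IsHermitian := hA.1.sub hB.1
  have hXs : IsSelfAdjoint (A - B) := hX
  set X := A - B with hXdef
  have hc := continuousOn_spectrum X
  set U : Matrix ι ι ℂ := cfc Real.sign X with hU
  have habs : cfc Real.sqrt (Xᴴ * X) = U * X := by
    have h1 : Xᴴ * X = cfc (fun x : ℝ => x * x) X := by
      rw [cfc_mul (fun x : ℝ => x) (fun x => x) X (hc _) (hc _), cfc_id' ℝ X, hX.eq]
    have h2 : U * X = cfc (fun x : ℝ => Real.sign x * x) X := by
      rw [cfc_mul Real.sign (fun x => x) X (hc _) (hc _), cfc_id' ℝ X hXs]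
    rw [h1, h2, ← cfc_comp Real.sqrt (fun x : ℝ => x * x) X hXs
      (((Matrix.finite_real_spectrum (A := X)).image _).continuousOn _) (hc _)]
    refine cfc_congr fun x _ => ?_
    simp only [Function.comp_apply, Real.sqrt_mul_self_eq_abs]
    rcases lt_trichotomy x 0 with h | h | h
    · simp [Real.sign_of_neg h, abs_of_neg h]
    · simp [h]
    · simp [Real.sign_of_pos h, abs_of_pos h]
  have hle : ∀ f : ℝ → ℝ, (∀ x, 0 ≤ f x) → (cfc f X).PosSemidef := by
    intro f hf
    open scoped MatrixOrder in
    exact Matrix.nonneg_iff_posSemidef.mp (cfc_nonneg fun x _ => hf x)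
  have h1 : (1 - U).PosSemidef := by
    have : 1 - U = cfc (fun x => 1 - Real.sign x) X := by
      rw [cfc_sub (fun _ => (1 : ℝ)) Real.sign X (hc _) (hc _), cfc_const_one ℝ X hXs]
    rw [this]
    refine hle _ fun x => ?_
    rcases Real.sign_apply_eq x with h | h | h <;> rw [h] <;> norm_num
  have h2 : (1 + U).PosSemidef := by
    have : 1 + U = cfc (fun x => 1 + Real.sign x) X := by
      rw [cfc_add X (fun _ => (1 : ℝ)) Real.sign (hc _) (hc _), cfc_const_one ℝ X hXs]
    rw [this]
    refine hle _ fun x => ?_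
    rcases Real.sign_apply_eq x with h | h | h <;> rw [h] <;> norm_num
  have hA' := (Complex.le_def.mp (h1.trace_mul_nonneg hA)).1
  have hB' := (Complex.le_def.mp (h2.trace_mul_nonneg hB)).1
  simp only [sub_mul, add_mul, one_mul, Matrix.trace_sub, Matrix.trace_add, Complex.sub_re,
    Complex.add_re, Complex.zero_re] at hA' hB'
  rw [traceNorm, habs, hXdef, mul_sub, Matrix.trace_sub, Complex.sub_re]
  linarith

/-! ### Bohr components of eigenoperators of the commutator with `H` -/

theorem sum_energyProj {H : Matrix ι ι ℂ} (hH : H.IsHermitian) :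
    ∑ E ∈ energies H, energyProj H E = 1 := by
  have hs : IsSelfAdjoint H := hH
  unfold energyProj
  rw [← cfc_sum _ H _ (fun i _ => continuousOn_spectrum H _), ← cfc_const_one ℝ H hs]
  refine cfc_congr fun x hx => ?_
  have : x ∈ energies H := by simpa [energies] using hx
  simp [Finset.sum_apply, this]

theorem mul_energyProj {H : Matrix ι ι ℂ} (hH : H.IsHermitian) (E : ℝ) :
    H * energyProj H E = (E : ℂ) • energyProj H E := by
  have hs : IsSelfAdjoint H := hH
  have h : H * energyProj H E = E • energyProj H E := by
    unfold energyProj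
    nth_rewrite 1 [← cfc_id' ℝ H hs]
    rw [← cfc_mul _ _ H (continuousOn_spectrum H _) (continuousOn_spectrum H _),
      ← cfc_smul _ _ H (continuousOn_spectrum H _)]
    refine cfc_congr fun x _ => ?_
    by_cases hx : x = E <;> simp [hx]
  rw [h]; rfl

theorem energyProj_mul {H : Matrix ι ι ℂ} (hH : H.IsHermitian) (E : ℝ) :
    energyProj H E * H = (E : ℂ) • energyProj H E := by
  have hs : IsSelfAdjoint H := hH
  have h : energyProj H E * H = E • energyProj H E := by
    unfold energyProj
    nth_rewrite 2 [← cfc_id' ℝ H hs]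
    rw [← cfc_mul _ _ H (continuousOn_spectrum H _) (continuousOn_spectrum H _),
      ← cfc_smul _ _ H (continuousOn_spectrum H _)]
    refine cfc_congr fun x _ => ?_
    by_cases hx : x = E <;> simp [hx]
  rw [h]; rfl

/-- The filtered operator as a single sum over pairs of energies, in place of the nested sum over
Bohr frequencies and the pairs with a given difference. -/
theorem filteredJump_eq_sum (f : ℝ → ℝ) (H A : Matrix ι ι ℂ) :
    filteredJump f H A = ∑ p ∈ energies H ×ˢ energies H,
      (f (p.1 - p.2) : ℂ) • (energyProj H p.1 * A * energyProj H p.2) := by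
  unfold filteredJump bohrComponent
  rw [← Finset.sum_fiberwise_of_maps_to (g := fun p : ℝ × ℝ => p.1 - p.2) (t := bohrFrequencies H)
    (fun p hp => Finset.mem_image_of_mem _ hp)]
  refine Finset.sum_congr rfl fun ν _ => ?_
  rw [Finset.smul_sum]
  refine Finset.sum_congr rfl fun p hp => ?_
  rw [(Finset.mem_filter.mp hp).2]

theorem filteredJump_sum {κ : Type*} (s : Finset κ) (f : ℝ → ℝ) (H : Matrix ι ι ℂ)
    (A : κ → Matrix ι ι ℂ) :
    filteredJump f H (∑ k ∈ s, A k) = ∑ k ∈ s, filteredJump f H (A k) := by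
  simp only [filteredJump_eq_sum, Finset.mul_sum, Finset.sum_mul, Finset.smul_sum]
  rw [Finset.sum_comm]

theorem filteredJump_smul (f : ℝ → ℝ) (H : Matrix ι ι ℂ) (z : ℂ) (A : Matrix ι ι ℂ) :
    filteredJump f H (z • A) = z • filteredJump f H A := by
  simp only [filteredJump_eq_sum, Matrix.mul_smul, Matrix.smul_mul, Finset.smul_sum, smul_comm z]

/-- If `[H, A] = ν A`, then `A` has the single Bohr frequency `ν`. -/
theorem filteredJump_of_commutator {H A : Matrix ι ι ℂ} (hH : H.IsHermitian) {ν : ℝ}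
    (hA : H * A - A * H = (ν : ℂ) • A) (f : ℝ → ℝ) :
    filteredJump f H A = (f ν : ℂ) • A := by
  have key : ∀ E E' : ℝ, (f (E - E') : ℂ) • (energyProj H E * A * energyProj H E') =
      (f ν : ℂ) • (energyProj H E * A * energyProj H E') := by
    intro E E'
    by_cases h : E - E' = ν
    · rw [h]
    · have h1 : (((E - E' - ν : ℝ) : ℂ)) • (energyProj H E * A * energyProj H E') = 0 := by
        have h2 := congrArg (fun X => energyProj H E * X * energyProj H E') hA
        simp only [mul_sub, sub_mul, Matrix.mul_smul, Matrix.smul_mul] at h2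
        rw [← Matrix.mul_assoc, energyProj_mul hH, ← Matrix.mul_assoc,
          Matrix.mul_assoc _ H, mul_energyProj hH] at h2
        simp only [Matrix.mul_smul, Matrix.smul_mul] at h2
        push_cast
        rw [sub_smul, sub_smul, h2, sub_self]
      have h3 : energyProj H E * A * energyProj H E' = 0 :=
        (smul_eq_zero.mp h1).resolve_left (by exact_mod_cast sub_ne_zero.mpr h)
      rw [h3, smul_zero, smul_zero]
  rw [filteredJump_eq_sum, Finset.sum_congr rfl fun p _ => key p.1 p.2, ← Finset.smul_sum,
    Finset.sum_product]
  simp only [← Finset.mul_sum, ← Finset.sum_mul]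
  rw [sum_energyProj hH, one_mul, mul_one]

/-- The coherent term vanishes as soon as `∑ₐ Lₐ† Lₐ` commutes with `H`, since `tanh 0 = 0`. -/
theorem coherentTerm_eq_zero {𝒜 : Type*} [Fintype 𝒜] (β : ℝ) {H : Matrix ι ι ℂ}
    (hH : H.IsHermitian) (L : 𝒜 → Matrix ι ι ℂ) (hL : Commute H (∑ a, (L a)ᴴ * L a)) :
    coherentTerm β H L = 0 := by
  have h := filteredJump_of_commutator hH (ν := 0) (A := ∑ a, (L a)ᴴ * L a)
    (by rw [hL.eq, sub_self]; simp) (fun ν => Real.tanh (β * ν / 4))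
  rw [filteredJump_sum] at h
  change (Complex.I / 2) • ∑ a, filteredJump (fun ν => Real.tanh (β * ν / 4)) H ((L a)ᴴ * L a) = 0
  rw [h]
  simp

/-! ### The canonical anticommutation relations -/

section Fock

variable {n : ℕ}

theorem annihilation_apply (i : Fin n) (T S : Finset (Fin n)) :
    annihilation i T S = if i ∈ S ∧ T = S.erase i then (-1) ^ (S.filter (· < i)).card else 0 := rfl

theorem annihilation_mul_apply (i : Fin n) (X : Matrix (Finset (Fin n)) (Finset (Fin n)) ℂ)
    (T S : Finset (Fin n)) : (X * annihilation i) T S =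
      if i ∈ S then X T (S.erase i) * (-1) ^ (S.filter (· < i)).card else 0 := by
  rw [Matrix.mul_apply]
  by_cases h : i ∈ S
  · rw [Finset.sum_eq_single (S.erase i)]
    · simp [annihilation_apply, h]
    · intro R _ hR; simp [annihilation_apply, hR]
    · simp
  · simp [annihilation_apply, h]

theorem mul_creation_apply (i : Fin n) (X : Matrix (Finset (Fin n)) (Finset (Fin n)) ℂ)
    (T S : Finset (Fin n)) : (X * creation i) T S =
      if i ∉ S then X T (insert i S) * (-1) ^ (S.filter (· < i)).card else 0 := by
  rw [Matrix.mul_apply]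
  by_cases h : i ∈ S
  · rw [Finset.sum_eq_zero]
    · simp [h]
    · intro R _
      have : ¬ (i ∈ R ∧ S = R.erase i) := by rintro ⟨_, rfl⟩; simp at h
      simp [creation, annihilation_apply, this]
  · rw [Finset.sum_eq_single (insert i S)]
    · simp [creation, annihilation_apply, h, Finset.filter_insert]
    · intro R _ hR
      have : ¬ (i ∈ R ∧ S = R.erase i) := by
        rintro ⟨h', rfl⟩; exact hR (Finset.insert_erase h').symm
      simp [creation, annihilation_apply, this]
    · simp

theorem neg_one_pow_card_erase (S : Finset (Fin n)) {j : Fin n} (hj : j ∈ S) (i : Fin n) :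
    (-1 : ℂ) ^ ((S.erase j).filter (· < i)).card =
      (if j < i then -1 else 1) * (-1) ^ (S.filter (· < i)).card := by
  rw [Finset.filter_erase]
  by_cases h : j < i
  · have hm : j ∈ S.filter (· < i) := by simp [hj, h]
    rw [← Finset.card_erase_add_one hm, pow_succ]; simp [h]
  · rw [Finset.erase_eq_of_notMem (by simp [h])]; simp [h]

theorem neg_one_pow_card_insert (S : Finset (Fin n)) {j : Fin n} (hj : j ∉ S) (i : Fin n) :
    (-1 : ℂ) ^ ((insert j S).filter (· < i)).card =
      (if j < i then -1 else 1) * (-1) ^ (S.filter (· < i)).card := by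
  rw [Finset.filter_insert]
  by_cases h : j < i
  · have hm : j ∉ S.filter (· < i) := by simp [hj]
    rw [if_pos h, Finset.card_insert_of_notMem hm, pow_succ]; simp [h]
  · simp [h]

/-- Both orders remove the same two modes; the Jordan–Wigner signs differ because removing the lower
mode first changes the count of modes below the other one. -/
theorem annihilation_anticomm (i j : Fin n) :
    annihilation i * annihilation j + annihilation j * annihilation i = 0 := by
  ext T S
  rw [Matrix.add_apply, annihilation_mul_apply, annihilation_mul_apply, Matrix.zero_apply]
  rcases eq_or_ne i j with rfl | hij
  · simp [annihilation_apply]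
  by_cases hi : i ∈ S <;> by_cases hj : j ∈ S
  · simp only [annihilation_apply, hi, hj, Finset.mem_erase, hij, hij.symm, ne_eq,
      not_false_eq_true, and_self, true_and, if_true, neg_one_pow_card_erase S hi,
      neg_one_pow_card_erase S hj, Finset.erase_right_comm (a := i) (b := j)]
    rcases lt_or_gt_of_ne hij with h | h
    · simp only [h, h.not_gt, if_true, if_false]; split_ifs <;> ring
    · simp only [h, h.not_gt, if_true, if_false]; split_ifs <;> ring
  all_goals simp [annihilation_apply, hi, hj]

theorem annihilation_creation_anticomm (i j : Fin n) :
    annihilation i * creation j + creation j * annihilation i = if i = j then 1 else 0 := by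
  ext T S
  rw [Matrix.add_apply, annihilation_mul_apply, mul_creation_apply]
  simp only [annihilation_apply, creation, Matrix.conjTranspose_apply]
  rcases eq_or_ne i j with rfl | hij
  · by_cases hi : i ∈ S
    · rw [if_neg (by simpa using hi)]
      by_cases hTS : T = S
      · subst hTS; simp [hi, ← mul_pow]
      · have : ¬ (i ∈ T ∧ S.erase i = T.erase i) := by
          rintro ⟨h1, h2⟩
          exact hTS (by rw [← Finset.insert_erase h1, ← h2, Finset.insert_erase hi])
        simp [this, hTS]
    · by_cases hTS : T = S
      · subst hTS; simp [hi, ← mul_pow, Finset.filter_insert]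
      · simp [hi, hTS]
  · rw [if_neg hij, Matrix.zero_apply]
    by_cases hi : i ∈ S <;> by_cases hj : j ∈ S
    · have : ¬ (j ∈ T ∧ S.erase i = T.erase j) := by
        rintro ⟨h1, h2⟩
        have : j ∈ T.erase j := h2 ▸ Finset.mem_erase.mpr ⟨hij.symm, hj⟩
        simp at this
      simp [hi, hj, this]
    · have e : (insert j S).erase i = insert j (S.erase i) := by
        rw [Finset.erase_insert_of_ne hij.symm]
      have hj' : j ∉ S.erase i := fun h => hj (Finset.mem_of_mem_erase h)
      have hc : (j ∈ T ∧ S.erase i = T.erase j) ↔ T = insert j (S.erase i) := by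
        constructor
        · rintro ⟨h1, h2⟩; rw [h2, Finset.insert_erase h1]
        · rintro rfl; exact ⟨Finset.mem_insert_self _ _, (Finset.erase_insert hj').symm⟩
      simp only [hi, hj, e, hc, not_false_eq_true, if_true, Finset.mem_insert, or_true, true_and,
        neg_one_pow_card_insert S hj]
      by_cases hT : T = insert j (S.erase i)
      · subst hT
        simp only [if_true, neg_one_pow_card_insert _ hj', neg_one_pow_card_erase S hi]
        rcases lt_or_gt_of_ne hij with h | h
        · simp only [h, h.not_gt, if_true, if_false]; simp; ring
        · simp only [h, h.not_gt, if_true, if_false]; simp; ring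
      · simp [hT]
    · simp [hi, hj]
    · simp [hi, hj, hij]

/-- The Fock representation is irreducible: only scalars commute with all creation and annihilation
operators. -/
theorem eq_smul_one_of_commute {X : Matrix (Finset (Fin n)) (Finset (Fin n)) ℂ}
    (h : ∀ i, Commute (annihilation i) X) (h' : ∀ i, Commute (creation i) X) :
    ∃ z : ℂ, X = z • 1 := by
  have hnum : ∀ (i : Fin n) T S, (creation i * annihilation i) T S =
      if i ∈ S ∧ T = S then 1 else 0 := by
    intro i T S
    rw [annihilation_mul_apply]
    simp only [annihilation_apply, creation, Matrix.conjTranspose_apply]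
    by_cases hi : i ∈ S
    · by_cases hTS : T = S
      · subst hTS; simp [hi, ← mul_pow]
      · have : ¬ (i ∈ T ∧ S.erase i = T.erase i) := by
          rintro ⟨h1, h2⟩
          exact hTS (by rw [← Finset.insert_erase h1, ← h2, Finset.insert_erase hi])
        simp [this, hTS]
    · simp [hi]
  -- `X` commutes with the occupation numbers, whose joint eigenspaces are spanned by the `|S⟩`.
  have hoff : ∀ T S, T ≠ S → X T S = 0 := by
    intro T S hTS
    obtain ⟨i, hi⟩ : ∃ i, ¬ (i ∈ T ↔ i ∈ S) := by
      by_contra! hc; exact hTS (Finset.ext hc)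
    have hc := congrFun (congrFun ((h' i).mul_left (h i)).eq T) S
    rw [Matrix.mul_apply, Matrix.mul_apply, Finset.sum_eq_single T, Finset.sum_eq_single S] at hc
    · simp only [hnum] at hc
      by_cases h1 : i ∈ T <;> by_cases h2 : i ∈ S <;> simp_all
    · intro R _ hR; simp [hnum, hR]
    · simp
    · intro R _ hR; simp [hnum, Ne.symm hR]
    · simp
  -- The entry of `cᵢ X = X cᵢ` at `(S, S ∪ {i})` equates neighbouring diagonal entries.
  have hdiag : ∀ i S, i ∉ S → X (insert i S) (insert i S) = X S S := by
    intro i S hi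
    have hc := congrFun (congrFun (h i).eq S) (insert i S)
    rw [annihilation_mul_apply, Matrix.mul_apply, Finset.sum_eq_single (insert i S)] at hc
    · simp only [annihilation_apply, Finset.mem_insert_self, Finset.erase_insert hi, and_self,
        if_true] at hc
      rw [mul_comm] at hc
      exact mul_right_cancel₀ (pow_ne_zero _ (by norm_num)) hc
    · intro R _ hR; rw [hoff _ _ hR, mul_zero]
    · simp
  refine ⟨X ∅ ∅, ?_⟩
  ext T S
  by_cases hTS : T = S
  · subst hTS
    simp only [Matrix.smul_apply, Matrix.one_apply_eq, smul_eq_mul, mul_one]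
    induction T using Finset.induction_on with
    | empty => rfl
    | insert i S hi ih => rw [hdiag i S hi, ih]
  · simp [hoff _ _ hTS, hTS]

end Fock

/-! ### Sandwich maps and positive trace-preserving maps -/

/-- The completely positive map `X ↦ A X A†`. -/
def sandwich (A : Matrix ι ι ℂ) : Module.End ℂ (Matrix ι ι ℂ) :=
  LinearMap.mulLeft ℂ A ∘ₗ LinearMap.mulRight ℂ Aᴴ

theorem sandwich_apply (A X : Matrix ι ι ℂ) : sandwich A X = A * X * Aᴴ := by
  simp [sandwich, Matrix.mul_assoc]

theorem sandwich_mul (A B : Matrix ι ι ℂ) : sandwich (A * B) = sandwich A * sandwich B := by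
  ext1 X
  simp [sandwich_apply, Module.End.mul_apply, Matrix.mul_assoc]

theorem sandwich_zero : sandwich (0 : Matrix ι ι ℂ) = 0 := by
  ext1 X
  simp [sandwich_apply]

/-- A relative sign drops out of a sandwich, so the sandwich maps of anticommuting operators
commute. -/
theorem commute_sandwich_of_anticomm {A B : Matrix ι ι ℂ} (h : A * B + B * A = 0) :
    Commute (sandwich A) (sandwich B) := by
  rw [Commute, SemiconjBy, ← sandwich_mul, ← sandwich_mul, eq_neg_of_add_eq_zero_left h]
  ext1 X
  simp [sandwich_apply]

theorem trace_sandwich (A X : Matrix ι ι ℂ) : (sandwich A X).trace = (Aᴴ * A * X).trace := by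
  rw [sandwich_apply, Matrix.trace_mul_comm, Matrix.mul_assoc]

theorem posSemidef_sandwich (A : Matrix ι ι ℂ) {X : Matrix ι ι ℂ} (hX : X.PosSemidef) :
    (sandwich A X).PosSemidef := by
  rw [sandwich_apply]
  exact hX.mul_mul_conjTranspose_same A

theorem _root_.Matrix.PosSemidef.ofReal_smul {X : Matrix ι ι ℂ} (hX : X.PosSemidef) {r : ℝ}
    (hr : 0 ≤ r) : ((r : ℂ) • X).PosSemidef :=
  hX.smul (Complex.zero_le_real.mpr hr)

/-- A positive trace-preserving linear map on matrices. -/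
structure IsPositiveTracePreserving (Φ : Module.End ℂ (Matrix ι ι ℂ)) : Prop where
  posSemidef : ∀ {X : Matrix ι ι ℂ}, X.PosSemidef → (Φ X).PosSemidef
  trace_eq : ∀ X : Matrix ι ι ℂ, (Φ X).trace = X.trace

theorem IsPositiveTracePreserving.isState {Φ : Module.End ℂ (Matrix ι ι ℂ)}
    (hΦ : IsPositiveTracePreserving Φ) {ρ : Matrix ι ι ℂ} (hρ : IsState ρ) : IsState (Φ ρ) :=
  ⟨hΦ.posSemidef hρ.1, by rw [hΦ.trace_eq, hρ.2]⟩

theorem isState_list_prod {κ : Type*} {Φ : κ → Module.End ℂ (Matrix ι ι ℂ)}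
    (hΦ : ∀ k, IsPositiveTracePreserving (Φ k)) (l : List κ) {ρ : Matrix ι ι ℂ} (hρ : IsState ρ) :
    IsState ((l.map Φ).prod ρ) := by
  induction l with
  | nil => simpa using hρ
  | cons k l ih => simpa using (hΦ k).isState ih

/-- `X` is a difference of two positive semidefinite matrices whose traces add up to at most `r`.
For Hermitian `X` this says that the trace norm of `X` is at most `r`, in a form that is visibly
preserved by positive trace-preserving maps. -/
def TraceBounded (X : Matrix ι ι ℂ) (r : ℝ) : Prop :=
  ∃ A B : Matrix ι ι ℂ, A.PosSemidef ∧ B.PosSemidef ∧ X = A - B ∧ A.trace.re + B.trace.re ≤ r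

theorem TraceBounded.traceNorm_le {X : Matrix ι ι ℂ} {r : ℝ} (h : TraceBounded X r) :
    traceNorm X ≤ r := by
  obtain ⟨A, B, hA, hB, rfl, hr⟩ := h
  exact (traceNorm_sub_le hA hB).trans hr

theorem TraceBounded.add {X Y : Matrix ι ι ℂ} {r s : ℝ} (hX : TraceBounded X r)
    (hY : TraceBounded Y s) : TraceBounded (X + Y) (r + s) := by
  obtain ⟨A, B, hA, hB, rfl, hr⟩ := hX
  obtain ⟨A', B', hA', hB', rfl, hs⟩ := hY
  refine ⟨A + A', B + B', hA.add hA', hB.add hB', by abel, ?_⟩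
  simp only [Matrix.trace_add, Complex.add_re]
  linarith

theorem TraceBounded.map {X : Matrix ι ι ℂ} {r : ℝ} (hX : TraceBounded X r)
    {Φ : Module.End ℂ (Matrix ι ι ℂ)} (hΦ : IsPositiveTracePreserving Φ) :
    TraceBounded (Φ X) r := by
  obtain ⟨A, B, hA, hB, rfl, hr⟩ := hX
  exact ⟨Φ A, Φ B, hΦ.posSemidef hA, hΦ.posSemidef hB, map_sub _ _ _, by
    rwa [hΦ.trace_eq, hΦ.trace_eq]⟩

/-- Telescoping: the distance between two products of positive trace-preserving maps is at most the
sum of the distances between the factors. -/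
theorem traceBounded_prod_sub_prod {κ : Type*} {Φ Ψ : κ → Module.End ℂ (Matrix ι ι ℂ)}
    (hΦ : ∀ k, IsPositiveTracePreserving (Φ k)) (hΨ : ∀ k, IsPositiveTracePreserving (Ψ k)) {r : ℝ}
    (h : ∀ k ρ, IsState ρ → TraceBounded (Φ k ρ - Ψ k ρ) r) (l : List κ) {ρ : Matrix ι ι ℂ}
    (hρ : IsState ρ) : TraceBounded ((l.map Φ).prod ρ - (l.map Ψ).prod ρ) (l.length * r) := by
  induction l with
  | nil => exact ⟨0, 0, .zero, .zero, by simp, by simp⟩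
  | cons k l ih =>
    have h1 := (ih.map (hΦ k)).add (h k _ (isState_list_prod hΨ l hρ))
    simp only [List.map_cons, List.prod_cons, Module.End.mul_apply, List.length_cons]
    convert h1 using 1
    · rw [map_sub]; abel
    · push_cast; ring

/-! ### Relaxation of a single fermionic mode -/

/-- An annihilation operator of a fermionic mode: `c² = 0` and `{c, c†} = 1`. -/
structure IsMode (c : Matrix ι ι ℂ) : Prop where
  sq_eq_zero : c * c = 0
  anticomm : c * cᴴ + cᴴ * c = 1

namespace IsMode

variable {c : Matrix ι ι ℂ}

theorem conjTranspose (hc : IsMode c) : IsMode cᴴ where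
  sq_eq_zero := by rw [← Matrix.conjTranspose_mul, hc.sq_eq_zero, Matrix.conjTranspose_zero]
  anticomm := by rw [Matrix.conjTranspose_conjTranspose, add_comm, hc.anticomm]

theorem mul_conjTranspose_mul (hc : IsMode c) : c * cᴴ * c = c := by
  have h := congrArg (· * c) hc.anticomm
  simpa [add_mul, Matrix.mul_assoc, hc.sq_eq_zero] using h

theorem sandwich_sq (hc : IsMode c) : sandwich c * sandwich c = 0 := by
  rw [← sandwich_mul, hc.sq_eq_zero, sandwich_zero]

theorem sandwich_mul_mul (hc : IsMode c) : sandwich c * sandwich cᴴ * sandwich c = sandwich c := by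
  rw [← sandwich_mul, ← sandwich_mul, hc.mul_conjTranspose_mul]

end IsMode

/-- The map which erases the coherences between the occupied and the empty states of the mode
`c`. -/
def dephase (c : Matrix ι ι ℂ) : Module.End ℂ (Matrix ι ι ℂ) :=
  sandwich c * sandwich cᴴ + sandwich cᴴ * sandwich c

/-- The map which resets the mode `c` to the state with occupation probability `p`. -/
def reset (p : ℝ) (c : Matrix ι ι ℂ) : Module.End ℂ (Matrix ι ι ℂ) :=
  (p : ℂ) • (sandwich cᴴ * sandwich c + sandwich cᴴ) +
    ((1 - p : ℝ) : ℂ) • (sandwich c * sandwich cᴴ + sandwich c)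

/-- Relaxation of the mode `c` towards occupation probability `p`: coherences are damped by the
factor `s` and deviations of the occupation number by `s ^ 2`. -/
def relax (p s : ℝ) (c : Matrix ι ι ℂ) : Module.End ℂ (Matrix ι ι ℂ) :=
  reset p c + ((s ^ 2 : ℝ) : ℂ) • (dephase c - reset p c) + (s : ℂ) • (1 - dephase c)

/-- The generator of the relaxation of the mode `c` towards occupation probability `p`: the
occupation number relaxes at rate `γ` and the coherences at rate `γ / 2`. -/
def modeGenerator (p γ : ℝ) (c : Matrix ι ι ℂ) : Module.End ℂ (Matrix ι ι ℂ) :=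
  ((-γ : ℝ) : ℂ) • (dephase c - reset p c) + ((-γ / 2 : ℝ) : ℂ) • (1 - dephase c)

/-- Particle-hole exchange of the mode exchanges the occupied and the empty state. -/
theorem reset_conjTranspose (p : ℝ) (c : Matrix ι ι ℂ) : reset p cᴴ = reset (1 - p) c := by
  rw [reset, reset, Matrix.conjTranspose_conjTranspose, add_comm, sub_sub_cancel]

/-- The reductions of words in the two sandwich maps of a mode, with the words bracketed to the
right. -/
theorem IsMode.sandwich_rules {c : Matrix ι ι ℂ} (hc : IsMode c)
    (x : Module.End ℂ (Matrix ι ι ℂ)) :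
    sandwich c * (sandwich c * x) = 0 ∧ sandwich cᴴ * (sandwich cᴴ * x) = 0 ∧
      sandwich c * (sandwich cᴴ * (sandwich c * x)) = sandwich c * x ∧
      sandwich cᴴ * (sandwich c * (sandwich cᴴ * x)) = sandwich cᴴ * x := by
  have hba := hc.conjTranspose.sandwich_mul_mul
  rw [Matrix.conjTranspose_conjTranspose] at hba
  refine ⟨?_, ?_, ?_, ?_⟩
  · rw [← mul_assoc, hc.sandwich_sq, zero_mul]
  · rw [← mul_assoc, hc.conjTranspose.sandwich_sq, zero_mul]
  · rw [← mul_assoc, ← mul_assoc, hc.sandwich_mul_mul]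
  · rw [← mul_assoc, ← mul_assoc, hba]

/-- `dephase` and `reset` are commuting projections, the range of `reset` lying in that of
`dephase`. -/
theorem IsMode.projections {c : Matrix ι ι ℂ} (hc : IsMode c) (p : ℝ) :
    dephase c * dephase c = dephase c ∧ dephase c * reset p c = reset p c ∧
      reset p c * dephase c = reset p c ∧ reset p c * reset p c = reset p c := by
  have ha := hc.sandwich_sq
  have hb := hc.conjTranspose.sandwich_sq
  have hr := hc.sandwich_rules
  have hab := hc.sandwich_mul_mul
  have hba := hc.conjTranspose.sandwich_mul_mul
  rw [Matrix.conjTranspose_conjTranspose] at hba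
  rw [mul_assoc] at hab hba
  unfold reset dephase
  generalize sandwich c = a at *
  generalize sandwich cᴴ = b at *
  -- `b * a + b` resets the mode to the occupied state and `a * b + a` to the empty one. In a
  -- product the outer reset prevails, and dephasing has no effect before or after a reset.
  have h1 : (b * a + b) * (b * a + b) = b * a + b := by
    simp [mul_add, add_mul, mul_assoc, hr, hb, hab, hba]
  have h2 : (b * a + b) * (a * b + a) = b * a + b := by
    simp [mul_add, add_mul, mul_assoc, hr, ha, hba, add_comm]
  have h3 : (a * b + a) * (b * a + b) = a * b + a := by
    simp [mul_add, add_mul, mul_assoc, hr, hb, hab, add_comm]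
  have h4 : (a * b + a) * (a * b + a) = a * b + a := by
    simp [mul_add, add_mul, mul_assoc, hr, ha, hab, hba]
  have h5 : (a * b + b * a) * (b * a + b) = b * a + b := by
    simp [mul_add, add_mul, mul_assoc, hr, hb, hab, hba]
  have h6 : (a * b + b * a) * (a * b + a) = a * b + a := by
    simp [mul_add, add_mul, mul_assoc, hr, ha, hab, hba]
  have h7 : (b * a + b) * (a * b + b * a) = b * a + b := by
    simp [mul_add, add_mul, mul_assoc, hr, hab, hba, add_comm]
  have h8 : (a * b + a) * (a * b + b * a) = a * b + a := by
    simp [mul_add, add_mul, mul_assoc, hr, hab, hba]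
  refine ⟨?_, ?_, ?_, ?_⟩
  · simp [mul_add, add_mul, mul_assoc, hr, hab, hba]
  · rw [mul_add, mul_smul_comm, mul_smul_comm, h5, h6]
  · rw [add_mul, smul_mul_assoc, smul_mul_assoc, h7, h8]
  · generalize b * a + b = u at *
    generalize a * b + a = v at *
    simp only [mul_add, add_mul, mul_smul_comm, smul_mul_assoc, h1, h2, h3, h4]
    push_cast
    module

theorem dephase_apply (c X : Matrix ι ι ℂ) :
    dephase c X = sandwich (c * cᴴ) X + sandwich (cᴴ * c) X := by
  simp [dephase, sandwich_mul]

theorem reset_apply (p : ℝ) (c X : Matrix ι ι ℂ) :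
    reset p c X = (p : ℂ) • (sandwich (cᴴ * c) X + sandwich cᴴ X) +
      ((1 - p : ℝ) : ℂ) • (sandwich (c * cᴴ) X + sandwich c X) := by
  simp [reset, sandwich_mul]

theorem IsMode.isPositiveTracePreserving_dephase {c : Matrix ι ι ℂ} (hc : IsMode c) :
    IsPositiveTracePreserving (dephase c) where
  posSemidef hX := by
    rw [dephase_apply]
    exact (posSemidef_sandwich _ hX).add (posSemidef_sandwich _ hX)
  trace_eq X := by
    rw [dephase_apply, Matrix.trace_add, trace_sandwich, trace_sandwich, ← Matrix.trace_add,
      ← add_mul]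
    simp only [Matrix.conjTranspose_mul, Matrix.conjTranspose_conjTranspose]
    rw [← Matrix.mul_assoc, ← Matrix.mul_assoc, hc.mul_conjTranspose_mul, Matrix.mul_assoc cᴴ,
      Matrix.mul_assoc cᴴ, hc.mul_conjTranspose_mul, hc.anticomm, one_mul]

theorem IsMode.trace_reset {c : Matrix ι ι ℂ} (hc : IsMode c) (p : ℝ) (X : Matrix ι ι ℂ) :
    (reset p c X).trace = X.trace := by
  have h : (c * cᴴ * X).trace + (cᴴ * c * X).trace = X.trace := by
    rw [← Matrix.trace_add, ← add_mul, hc.anticomm, one_mul]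
  simp only [reset_apply, Matrix.trace_add, Matrix.trace_smul, trace_sandwich]
  simp only [Matrix.conjTranspose_mul, Matrix.conjTranspose_conjTranspose]
  rw [← Matrix.mul_assoc (cᴴ * c), ← Matrix.mul_assoc (c * cᴴ), hc.mul_conjTranspose_mul,
    Matrix.mul_assoc cᴴ, Matrix.mul_assoc cᴴ, hc.mul_conjTranspose_mul]
  rw [add_comm (cᴴ * c * X).trace, h]
  simp only [smul_eq_mul]
  push_cast
  ring

/-- `relax` is a mixture, with weights `p` and `1 - p`, of the amplitude damping channels towards
the occupied and towards the empty state. -/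
theorem IsMode.relax_apply {c : Matrix ι ι ℂ} (hc : IsMode c) (p s : ℝ) (X : Matrix ι ι ℂ) :
    relax p s c X =
      (p : ℂ) • (sandwich (cᴴ * c + (s : ℂ) • (c * cᴴ)) X +
        ((1 - s ^ 2 : ℝ) : ℂ) • sandwich cᴴ X) +
      ((1 - p : ℝ) : ℂ) • (sandwich ((s : ℂ) • (cᴴ * c) + c * cᴴ) X +
        ((1 - s ^ 2 : ℝ) : ℂ) • sandwich c X) := by
  have hX : X = (c * cᴴ + cᴴ * c) * X * (c * cᴴ + cᴴ * c) := by
    rw [hc.anticomm, one_mul, mul_one]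
  have hexp : (1 - dephase c) X = c * cᴴ * X * (cᴴ * c) + cᴴ * c * X * (c * cᴴ) := by
    rw [LinearMap.sub_apply, Module.End.one_apply, dephase_apply, sandwich_apply,
      sandwich_apply]
    nth_rewrite 1 [hX]
    simp only [Matrix.conjTranspose_mul, Matrix.conjTranspose_conjTranspose]
    generalize c * cᴴ = m
    generalize cᴴ * c = k
    noncomm_ring
  rw [relax, LinearMap.add_apply, LinearMap.add_apply, LinearMap.smul_apply, LinearMap.smul_apply,
    hexp, LinearMap.sub_apply, reset_apply, dephase_apply]
  simp only [sandwich_apply, Matrix.conjTranspose_mul, Matrix.conjTranspose_conjTranspose,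
    Matrix.conjTranspose_add, Matrix.conjTranspose_smul, Complex.star_def, Complex.conj_ofReal]
  generalize cᴴ * X * c = v
  generalize c * X * cᴴ = u
  generalize c * cᴴ = m
  generalize cᴴ * c = k
  simp only [mul_add, add_mul, Matrix.mul_smul, Matrix.smul_mul]
  push_cast
  module

theorem IsMode.isPositiveTracePreserving_relax {c : Matrix ι ι ℂ} (hc : IsMode c) {p s : ℝ}
    (hp : 0 ≤ p) (hp' : p ≤ 1) (hs : 0 ≤ s) (hs' : s ≤ 1) :
    IsPositiveTracePreserving (relax p s c) where
  posSemidef {X} hX := by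
    have h : (0 : ℝ) ≤ 1 - s ^ 2 := by nlinarith
    rw [hc.relax_apply]
    exact (((posSemidef_sandwich _ hX).add ((posSemidef_sandwich _ hX).ofReal_smul h)).ofReal_smul
      hp).add (((posSemidef_sandwich _ hX).add
        ((posSemidef_sandwich _ hX).ofReal_smul h)).ofReal_smul (sub_nonneg.mpr hp'))
  trace_eq X := by
    simp [relax, Matrix.trace_add, Matrix.trace_sub, hc.trace_reset,
      hc.isPositiveTracePreserving_dephase.trace_eq]

theorem relax_zero (p : ℝ) (c : Matrix ι ι ℂ) : relax p 0 c = reset p c := by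
  simp [relax]

theorem IsMode.isPositiveTracePreserving_reset {c : Matrix ι ι ℂ} (hc : IsMode c) {p : ℝ}
    (hp : 0 ≤ p) (hp' : p ≤ 1) : IsPositiveTracePreserving (reset p c) := by
  rw [← relax_zero]
  exact hc.isPositiveTracePreserving_relax hp hp' le_rfl zero_le_one

/-- The distance of a partially relaxed state from the fully relaxed one. -/
theorem IsMode.traceBounded_relax_sub_reset {c : Matrix ι ι ℂ} (hc : IsMode c) {p s r : ℝ}
    (hp : 0 ≤ p) (hp' : p ≤ 1) (hs : 0 ≤ s) (hs' : s ≤ 1) (hr : s ≤ r) {ρ : Matrix ι ι ℂ}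
    (hρ : IsState ρ) : TraceBounded (relax p s c ρ - reset p c ρ) (4 * r) := by
  have hd := hc.isPositiveTracePreserving_dephase
  have he := hc.isPositiveTracePreserving_reset hp hp'
  have hs2 : (0 : ℝ) ≤ s ^ 2 := sq_nonneg s
  refine ⟨((s ^ 2 : ℝ) : ℂ) • dephase c ρ + (s : ℂ) • ρ,
    ((s ^ 2 : ℝ) : ℂ) • reset p c ρ + (s : ℂ) • dephase c ρ,
    ((hd.posSemidef hρ.1).ofReal_smul hs2).add (hρ.1.ofReal_smul hs),
    ((he.posSemidef hρ.1).ofReal_smul hs2).add ((hd.posSemidef hρ.1).ofReal_smul hs), ?_, ?_⟩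
  · simp only [relax, LinearMap.add_apply, LinearMap.smul_apply, LinearMap.sub_apply,
      Module.End.one_apply]
    module
  · simp only [Matrix.trace_add, Matrix.trace_smul, hd.trace_eq, he.trace_eq, hρ.2, smul_eq_mul,
      mul_one, Complex.add_re, Complex.ofReal_re]
    nlinarith

/-- The range of `reset p c` consists of operators which satisfy the detailed balance relation
`(1 - p) c Y = p Y c`. -/
theorem IsMode.smul_mul_eq_of_reset_eq {c : Matrix ι ι ℂ} (hc : IsMode c) {p : ℝ}
    {Y : Matrix ι ι ℂ} (hY : reset p c Y = Y) :
    ((1 - p : ℝ) : ℂ) • (c * Y) = (p : ℂ) • (Y * c) := by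
  have h1 : c * Y = (p : ℂ) • (c * Y * (cᴴ * c) + c * cᴴ * Y * c) := by
    conv_lhs => rw [← hY, reset_apply]
    simp only [sandwich_apply, Matrix.conjTranspose_mul, Matrix.conjTranspose_conjTranspose,
      mul_add, Matrix.mul_smul, ← Matrix.mul_assoc, hc.sq_eq_zero, hc.mul_conjTranspose_mul]
    simp
  have h2 : Y * c = ((1 - p : ℝ) : ℂ) • (c * Y * (cᴴ * c) + c * cᴴ * Y * c) := by
    conv_lhs => rw [← hY, reset_apply]
    have h3 : ∀ Z : Matrix ι ι ℂ, Z * c * c = 0 := fun Z => by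
      rw [Matrix.mul_assoc, hc.sq_eq_zero, mul_zero]
    have h4 : ∀ Z : Matrix ι ι ℂ, Z * c * cᴴ * c = Z * c := fun Z => by
      rw [Matrix.mul_assoc, Matrix.mul_assoc, ← Matrix.mul_assoc c, hc.mul_conjTranspose_mul]
    simp only [sandwich_apply, Matrix.conjTranspose_mul, Matrix.conjTranspose_conjTranspose,
      add_mul, Matrix.smul_mul, ← Matrix.mul_assoc, h3, h4]
    simp [add_comm]
  rw [h1, h2, smul_comm]

/-- The generator of mode relaxation in Lindblad form, with loss rate `γ (1 - p)` and gain rate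
`γ p`. -/
theorem IsMode.modeGenerator_apply {c : Matrix ι ι ℂ} (hc : IsMode c) (p γ : ℝ)
    (X : Matrix ι ι ℂ) : modeGenerator p γ c X =
      ((γ * (1 - p) : ℝ) : ℂ) •
        (c * X * cᴴ - (1 / 2 : ℂ) • (cᴴ * c * X + X * (cᴴ * c))) +
      ((γ * p : ℝ) : ℂ) • (cᴴ * X * c - (1 / 2 : ℂ) • (c * cᴴ * X + X * (c * cᴴ))) := by
  have hk : cᴴ * c = 1 - c * cᴴ := by rw [← hc.anticomm]; abel
  rw [modeGenerator, LinearMap.add_apply, LinearMap.smul_apply, LinearMap.smul_apply,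
    LinearMap.sub_apply, LinearMap.sub_apply, reset_apply, dephase_apply,
    Module.End.one_apply]
  simp only [sandwich_apply, Matrix.conjTranspose_mul, Matrix.conjTranspose_conjTranspose]
  generalize cᴴ * X * c = v
  generalize c * X * cᴴ = u
  rw [hk]
  generalize c * cᴴ = m
  simp only [mul_sub, sub_mul, one_mul, mul_one, smul_add, smul_sub]
  push_cast
  module

/-! ### Semigroups generated by commuting modes -/

section Commute

variable {c c' : Matrix ι ι ℂ}

theorem commute_mode_maps {x : Module.End ℂ (Matrix ι ι ℂ)} (h1 : Commute x (sandwich c))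
    (h2 : Commute x (sandwich cᴴ)) (p : ℝ) :
    Commute x (dephase c) ∧ Commute x (reset p c) := by
  have h3 := h1.mul_right h2
  have h4 := h2.mul_right h1
  exact ⟨h3.add_right h4, ((h4.add_right h2).smul_right _).add_right
    ((h3.add_right h1).smul_right _)⟩

theorem commute_dephase_reset (h : c * c' + c' * c = 0) (h' : c * c'ᴴ + c'ᴴ * c = 0) (p p' : ℝ) :
    Commute (dephase c) (dephase c') ∧ Commute (dephase c) (reset p' c') ∧
      Commute (reset p c) (dephase c') ∧ Commute (reset p c) (reset p' c') := by
  have k1 : cᴴ * c'ᴴ + c'ᴴ * cᴴ = 0 := by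
    simpa [add_comm] using congrArg Matrix.conjTranspose h
  have k2 : cᴴ * c' + c' * cᴴ = 0 := by
    simpa [add_comm] using congrArg Matrix.conjTranspose h'
  have a1 := commute_mode_maps (commute_sandwich_of_anticomm h) (commute_sandwich_of_anticomm h') p'
  have a2 := commute_mode_maps (commute_sandwich_of_anticomm k2)
    (commute_sandwich_of_anticomm k1) p'
  have b1 := commute_mode_maps a1.1.symm a2.1.symm p
  have b2 := commute_mode_maps a1.2.symm a2.2.symm p
  exact ⟨b1.1.symm, b2.1.symm, b1.2.symm, b2.2.symm⟩

theorem commute_reset (h : c * c' + c' * c = 0) (h' : c * c'ᴴ + c'ᴴ * c = 0) (p p' : ℝ) :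
    Commute (reset p c) (reset p' c') :=
  (commute_dephase_reset h h' p p').2.2.2

theorem commute_modeGenerator (h : c * c' + c' * c = 0) (h' : c * c'ᴴ + c'ᴴ * c = 0)
    (p p' γ γ' : ℝ) : Commute (modeGenerator p γ c) (modeGenerator p' γ' c') := by
  obtain ⟨h1, h2, h3, h4⟩ := commute_dephase_reset h h' p p'
  have k1 : Commute (dephase c) (modeGenerator p' γ' c') :=
    ((h1.sub_right h2).smul_right _).add_right
      (((Commute.one_right _).sub_right h1).smul_right _)
  have k2 : Commute (reset p c) (modeGenerator p' γ' c') :=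
    ((h3.sub_right h4).smul_right _).add_right
      (((Commute.one_right _).sub_right h3).smul_right _)
  exact ((k1.sub_left k2).smul_left _).add_left
    (((Commute.one_left _).sub_left k1).smul_left _)

end Commute

section Exp

variable {𝔸 : Type*} [NormedRing 𝔸] [NormedAlgebra ℂ 𝔸] [CompleteSpace 𝔸]

/-- All powers of `x • P` but the zeroth are multiples of `P`, so the exponential series differs
from `exp x • P` in its zeroth term only. -/
theorem exp_smul_of_isIdempotentElem {P : 𝔸} (hP : IsIdempotentElem P) (x : ℂ) :
    NormedSpace.exp (x • P) = 1 + (Complex.exp x - 1) • P := by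
  have h1 : HasSum (fun n : ℕ => (((n.factorial : ℂ)⁻¹ • x ^ n) : ℂ) • P)
      (Complex.exp x • P) := by
    rw [Complex.exp_eq_exp_ℂ]
    exact (NormedSpace.exp_series_hasSum_exp' (𝕂 := ℂ) x).smul_const P
  have h2 := h1.add (hasSum_ite_eq (0 : ℕ) (1 - P))
  have h3 := NormedSpace.exp_series_hasSum_exp' (𝕂 := ℂ) (x • P)
  have h4 : (fun n : ℕ => ((n.factorial : ℂ)⁻¹) • (x • P) ^ n) =
      fun n : ℕ => (((n.factorial : ℂ)⁻¹ • x ^ n) : ℂ) • P + if n = 0 then 1 - P else 0 := by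
    funext n
    rcases Nat.eq_zero_or_pos n with rfl | hn
    · simp
    · rw [smul_pow, hP.pow_eq hn.ne', if_neg hn.ne', add_zero, smul_assoc]
  rw [h4] at h3
  rw [h3.unique h2]
  module

theorem exp_add_smul_of_isIdempotentElem {P Q : 𝔸} (hP : IsIdempotentElem P)
    (hQ : IsIdempotentElem Q) (hPQ : P * Q = 0) (hQP : Q * P = 0) (x y : ℂ) :
    NormedSpace.exp (x • P + y • Q) =
      1 + (Complex.exp x - 1) • P + (Complex.exp y - 1) • Q := by
  let _ : NormedAlgebra ℚ 𝔸 := NormedAlgebra.restrictScalars ℚ ℂ 𝔸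
  have hc : Commute P Q := by rw [Commute, SemiconjBy, hPQ, hQP]
  rw [NormedSpace.exp_add_of_commute ((hc.smul_left x).smul_right y),
    exp_smul_of_isIdempotentElem hP, exp_smul_of_isIdempotentElem hQ]
  simp [mul_add, add_mul, hPQ]

theorem exp_list_sum_of_commute {κ : Type*} (x : κ → 𝔸) (hx : ∀ k j, Commute (x k) (x j))
    (l : List κ) :
    NormedSpace.exp (l.map x).sum = (l.map fun k => NormedSpace.exp (x k)).prod := by
  let _ : NormedAlgebra ℚ 𝔸 := NormedAlgebra.restrictScalars ℚ ℂ 𝔸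
  induction l with
  | nil => simp
  | cons k l ih =>
    rw [List.map_cons, List.sum_cons, NormedSpace.exp_add_of_commute, ih, List.map_cons,
      List.prod_cons]
    refine Commute.list_sum_right _ _ fun y hy => ?_
    obtain ⟨j, -, rfl⟩ := List.mem_map.mp hy
    exact hx k j

end Exp

open scoped Matrix.Norms.L2Operator in
/-- The semigroup generated by a sum of commuting mode generators. -/
theorem evolution_sum_modeGenerator {n : ℕ} {c : Fin n → Matrix ι ι ℂ} (hc : ∀ k, IsMode (c k))
    (p γ : Fin n → ℝ)
    (hcomm : ∀ k j, Commute (modeGenerator (p k) (γ k) (c k)) (modeGenerator (p j) (γ j) (c j)))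
    (t : ℝ) (ρ : Matrix ι ι ℂ) :
    evolution (∑ k, modeGenerator (p k) (γ k) (c k)) t ρ =
      ((List.finRange n).map fun k => relax (p k) (Real.exp (-(γ k * t) / 2)) (c k)).prod ρ := by
  set e := Module.End.toContinuousLinearMap (𝕜 := ℂ) (Matrix ι ι ℂ) with he
  have h1 : ∀ k, NormedSpace.exp (e ((t : ℂ) • modeGenerator (p k) (γ k) (c k))) =
      e (relax (p k) (Real.exp (-(γ k * t) / 2)) (c k)) := by
    intro k
    obtain ⟨q1, q2, q3, q4⟩ := (hc k).projections (p k)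
    have hP : IsIdempotentElem (dephase (c k) - reset (p k) (c k)) := by
      rw [IsIdempotentElem, sub_mul, mul_sub, mul_sub, q1, q2, q3, q4, sub_self, sub_zero]
    have hQ : IsIdempotentElem (1 - dephase (c k)) := by
      rw [IsIdempotentElem, sub_mul, mul_sub, mul_sub, q1]; simp
    have hPQ : (dephase (c k) - reset (p k) (c k)) * (1 - dephase (c k)) = 0 := by
      rw [sub_mul, mul_sub, mul_sub, q1, q3]; simp
    have hQP : (1 - dephase (c k)) * (dephase (c k) - reset (p k) (c k)) = 0 := by
      rw [sub_mul, mul_sub, mul_sub, q1, q2]; simp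
    have h2 := exp_add_smul_of_isIdempotentElem (hP.map e) (hQ.map e)
      (by rw [← map_mul, hPQ, map_zero]) (by rw [← map_mul, hQP, map_zero])
      (-(γ k * t) : ℝ) (-(γ k * t) / 2 : ℝ)
    rw [modeGenerator, smul_add, smul_smul, smul_smul, map_add, map_smul, map_smul]
    have a1 : (t : ℂ) * ((-γ k : ℝ) : ℂ) = ((-(γ k * t) : ℝ) : ℂ) := by push_cast; ring
    have a2 : (t : ℂ) * ((-γ k / 2 : ℝ) : ℂ) = ((-(γ k * t) / 2 : ℝ) : ℂ) := by push_cast; ring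
    rw [a1, a2, h2, ← map_one e, ← map_smul, ← map_smul, ← map_add, ← map_add]
    congr 1
    rw [relax, ← Complex.ofReal_exp, ← Complex.ofReal_exp]
    have a3 : Real.exp (-(γ k * t)) = Real.exp (-(γ k * t) / 2) ^ 2 := by
      rw [← Real.exp_nat_mul]; congr 1; push_cast; ring
    rw [a3]
    module
  have h3 : (t : ℂ) • e (∑ k, modeGenerator (p k) (γ k) (c k)) =
      ((List.finRange n).map fun k => e ((t : ℂ) • modeGenerator (p k) (γ k) (c k))).sum := by
    rw [← map_smul, Finset.smul_sum, map_sum, Fin.sum_univ_def]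
  have h4 : NormedSpace.exp ((t : ℂ) • e (∑ k, modeGenerator (p k) (γ k) (c k))) =
      e ((List.finRange n).map fun k =>
        relax (p k) (Real.exp (-(γ k * t) / 2)) (c k)).prod := by
    rw [h3, exp_list_sum_of_commute _ fun k j =>
      (((hcomm k j).smul_left _).smul_right _).map e]
    simp only [h1]
    rw [map_list_prod, List.map_map]
    rfl
  exact congrArg (fun Φ : Matrix ι ι ℂ →L[ℂ] Matrix ι ι ℂ => Φ ρ) h4

/-! ### Normal modes of a quadratic Hamiltonian -/

section NormalModes

variable {n : ℕ}

/-- The annihilation operator `∑ᵢ Uᵢₖ cᵢ` of the `k`-th normal mode. -/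
def normalMode (U : Matrix (Fin n) (Fin n) ℝ) (k : Fin n) :
    Matrix (Finset (Fin n)) (Finset (Fin n)) ℂ :=
  ∑ i, (U i k : ℂ) • annihilation i

theorem conjTranspose_normalMode (U : Matrix (Fin n) (Fin n) ℝ) (k : Fin n) :
    (normalMode U k)ᴴ = ∑ i, (U i k : ℂ) • creation i := by
  simp [normalMode, creation, Matrix.conjTranspose_sum, Matrix.conjTranspose_smul]

theorem sum_mul_eq_of_transpose_mul {U : Matrix (Fin n) (Fin n) ℝ} (hU : Uᵀ * U = 1)
    (k l : Fin n) : ∑ i, (U i k : ℂ) * (U i l : ℂ) = if k = l then 1 else 0 := by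
  have h := congrFun (congrFun hU k) l
  rw [Matrix.mul_apply, Matrix.one_apply] at h
  simp only [Matrix.transpose_apply] at h
  have h' := congrArg (fun x : ℝ => (x : ℂ)) h
  push_cast at h'
  rw [h']
  split_ifs <;> simp

/-- An orthogonal rotation of the index drops out of a sum of sandwiches. -/
theorem sum_rotated_sandwich {U : Matrix (Fin n) (Fin n) ℝ} (hU : Uᵀ * U = 1)
    (A B : Fin n → Matrix ι ι ℂ) (X : Matrix ι ι ℂ) :
    ∑ i, (∑ k, (U i k : ℂ) • A k) * X * (∑ l, (U i l : ℂ) • B l) = ∑ k, A k * X * B k := by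
  have h : ∀ i, (∑ k, (U i k : ℂ) • A k) * X * (∑ l, (U i l : ℂ) • B l) =
      ∑ k, ∑ l, ((U i k : ℂ) * (U i l : ℂ)) • (A k * X * B l) := by
    intro i
    simp only [Finset.sum_mul, Finset.mul_sum, Matrix.smul_mul, Matrix.mul_smul, smul_smul]
    rw [Finset.sum_comm]
    simp only [mul_comm]
  simp only [h]
  rw [Finset.sum_comm]
  refine Finset.sum_congr rfl fun k _ => ?_
  rw [Finset.sum_comm]
  simp only [← Finset.sum_smul, sum_mul_eq_of_transpose_mul hU, ite_smul, one_smul, zero_smul]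
  simp

theorem annihilation_eq_sum_normalMode {U : Matrix (Fin n) (Fin n) ℝ} (hU : U * Uᵀ = 1)
    (i : Fin n) : annihilation i = ∑ k, (U i k : ℂ) • normalMode U k := by
  have h := sum_mul_eq_of_transpose_mul (U := Uᵀ) (by rwa [Matrix.transpose_transpose])
  simp only [Matrix.transpose_apply] at h
  simp only [normalMode, Finset.smul_sum, smul_smul]
  rw [Finset.sum_comm]
  simp only [← Finset.sum_smul, h]
  simp

theorem creation_eq_sum_normalMode {U : Matrix (Fin n) (Fin n) ℝ} (hU : U * Uᵀ = 1)
    (i : Fin n) : creation i = ∑ k, (U i k : ℂ) • (normalMode U k)ᴴ := by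
  rw [creation, annihilation_eq_sum_normalMode hU]
  simp [Matrix.conjTranspose_sum, Matrix.conjTranspose_smul]

theorem normalMode_anticomm (U : Matrix (Fin n) (Fin n) ℝ) (k l : Fin n) :
    normalMode U k * normalMode U l + normalMode U l * normalMode U k = 0 := by
  simp only [normalMode, Finset.sum_mul, Finset.mul_sum, Matrix.smul_mul, Matrix.mul_smul,
    smul_smul]
  nth_rewrite 1 [Finset.sum_comm]
  rw [← Finset.sum_add_distrib]
  refine Finset.sum_eq_zero fun i _ => ?_
  rw [← Finset.sum_add_distrib]
  refine Finset.sum_eq_zero fun j _ => ?_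
  rw [mul_comm, ← smul_add]
  simp [annihilation_anticomm]

theorem normalMode_conjTranspose_anticomm {U : Matrix (Fin n) (Fin n) ℝ} (hU : Uᵀ * U = 1)
    (k l : Fin n) : normalMode U k * (normalMode U l)ᴴ + (normalMode U l)ᴴ * normalMode U k =
      if k = l then 1 else 0 := by
  have h1 : normalMode U k * (normalMode U l)ᴴ =
      ∑ i, ∑ j, ((U i k : ℂ) * (U j l : ℂ)) • (annihilation i * creation j) := by
    rw [conjTranspose_normalMode, normalMode, Finset.sum_mul]
    simp only [Finset.mul_sum, Matrix.smul_mul, Matrix.mul_smul, smul_smul]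
    simp only [mul_comm]
  have h2 : (normalMode U l)ᴴ * normalMode U k =
      ∑ i, ∑ j, ((U i k : ℂ) * (U j l : ℂ)) • (creation j * annihilation i) := by
    rw [conjTranspose_normalMode, normalMode, Finset.mul_sum]
    simp only [Finset.sum_mul, Matrix.smul_mul, Matrix.mul_smul, smul_smul]
  rw [h1, h2]
  simp only [← Finset.sum_add_distrib, ← smul_add, annihilation_creation_anticomm, smul_ite,
    smul_zero, Finset.sum_ite_eq, Finset.mem_univ, if_true, ← Finset.sum_smul,
    sum_mul_eq_of_transpose_mul hU]
  split_ifs <;> simp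

theorem isMode_normalMode {U : Matrix (Fin n) (Fin n) ℝ} (hU : Uᵀ * U = 1) (k : Fin n) :
    IsMode (normalMode U k) where
  sq_eq_zero := by
    have h := normalMode_anticomm U k k
    rw [← two_smul ℂ] at h
    exact (smul_eq_zero.mp h).resolve_left two_ne_zero
  anticomm := by rw [normalMode_conjTranspose_anticomm hU, if_pos rfl]

theorem isHermitian_freeHamiltonian {M : Matrix (Fin n) (Fin n) ℝ} (hM : M.IsHermitian) :
    (freeHamiltonian M).IsHermitian := by
  have h : ∀ i j, M j i = M i j := fun i j => by simpa using hM.apply i j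
  rw [Matrix.IsHermitian, freeHamiltonian]
  simp only [Matrix.conjTranspose_sum, Matrix.conjTranspose_smul, Matrix.conjTranspose_mul,
    creation, Matrix.conjTranspose_conjTranspose, Complex.star_def, Complex.conj_ofReal]
  rw [Finset.sum_comm]
  simp only [h]

/-- A quadratic Hamiltonian acts on annihilation operators by its single-particle matrix. -/
theorem freeHamiltonian_commutator (M : Matrix (Fin n) (Fin n) ℝ) (l : Fin n) :
    freeHamiltonian M * annihilation l - annihilation l * freeHamiltonian M =
      -∑ j, (M l j : ℂ) • annihilation j := by
  have h : ∀ i j : Fin n, creation i * annihilation j * annihilation l -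
      annihilation l * (creation i * annihilation j) = if l = i then -annihilation j else 0 := by
    intro i j
    have h1 : annihilation l * creation i =
        (if l = i then 1 else 0) - creation i * annihilation l :=
      eq_sub_of_add_eq (annihilation_creation_anticomm l i)
    have h2 : annihilation j * annihilation l = -(annihilation l * annihilation j) :=
      eq_neg_of_add_eq_zero_left (annihilation_anticomm j l)
    rw [← Matrix.mul_assoc, h1, Matrix.mul_assoc, h2, sub_mul, Matrix.mul_assoc]
    split_ifs
    · rw [one_mul, mul_neg]; abel
    · simp
  simp only [freeHamiltonian, Finset.sum_mul, Finset.mul_sum, Matrix.smul_mul, Matrix.mul_smul]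
  simp only [← Finset.sum_sub_distrib, ← smul_sub, h]
  rw [Finset.sum_eq_single l]
  · simp
  · intro i _ hi; simp [Ne.symm hi]
  · simp

theorem normalMode_commutator {M U : Matrix (Fin n) (Fin n) ℝ} (hM : M.IsHermitian) {e : Fin n → ℝ}
    (hMU : ∀ i k, ∑ j, M i j * U j k = e k * U i k) (k : Fin n) :
    freeHamiltonian M * normalMode U k - normalMode U k * freeHamiltonian M =
      ((-e k : ℝ) : ℂ) • normalMode U k := by
  have hs : ∀ i j, M j i = M i j := fun i j => by simpa using hM.apply i j
  have h1 : freeHamiltonian M * normalMode U k - normalMode U k * freeHamiltonian M =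
      ∑ l, (U l k : ℂ) • -∑ j, (M l j : ℂ) • annihilation j := by
    simp only [← freeHamiltonian_commutator, normalMode, Finset.mul_sum, Finset.sum_mul,
      Matrix.mul_smul, Matrix.smul_mul, ← Finset.sum_sub_distrib, smul_sub]
  rw [h1]
  simp only [smul_neg, Finset.sum_neg_distrib, Finset.smul_sum, smul_smul, normalMode]
  rw [Finset.sum_comm, ← Finset.sum_neg_distrib]
  refine Finset.sum_congr rfl fun j _ => ?_
  rw [← Finset.sum_smul, ← neg_smul]
  congr 1
  have h2 : ∑ l, U l k * M l j = e k * U j k := by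
    rw [← hMU j k]
    exact Finset.sum_congr rfl fun l _ => by rw [hs j l, mul_comm]
  have h3 := congrArg (fun x : ℝ => (x : ℂ)) h2
  push_cast at h3 ⊢
  rw [h3, neg_mul]

theorem normalMode_conjTranspose_commutator {M U : Matrix (Fin n) (Fin n) ℝ} (hM : M.IsHermitian)
    {e : Fin n → ℝ} (hMU : ∀ i k, ∑ j, M i j * U j k = e k * U i k) (k : Fin n) :
    freeHamiltonian M * (normalMode U k)ᴴ - (normalMode U k)ᴴ * freeHamiltonian M =
      (e k : ℂ) • (normalMode U k)ᴴ := by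
  have h := congrArg Matrix.conjTranspose (normalMode_commutator hM hMU k)
  simp only [Matrix.conjTranspose_sub, Matrix.conjTranspose_mul, Matrix.conjTranspose_smul,
    (isHermitian_freeHamiltonian hM).eq, Complex.star_def, Complex.conj_ofReal] at h
  rw [← neg_sub, h, ← neg_smul]
  simp

/-- The occupation probability `1 / (1 + e^{βε})` of a mode of energy `ε` in thermal equilibrium,
written symmetrically. -/
def fermiOccupation (β ε : ℝ) : ℝ := Real.exp (-(β * ε) / 2) / (2 * Real.cosh (β * ε / 2))

theorem one_sub_fermiOccupation (β ε : ℝ) :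
    1 - fermiOccupation β ε = Real.exp (β * ε / 2) / (2 * Real.cosh (β * ε / 2)) := by
  have h : 2 * Real.cosh (β * ε / 2) = Real.exp (β * ε / 2) + Real.exp (-(β * ε) / 2) := by
    rw [Real.cosh_eq, neg_div]; ring
  have h' : Real.exp (β * ε / 2) + Real.exp (-(β * ε) / 2) ≠ 0 := by positivity
  rw [fermiOccupation, h]
  field_simp
  ring

theorem fermiOccupation_pos (β ε : ℝ) : 0 < fermiOccupation β ε := by
  have := Real.cosh_pos (β * ε / 2)
  unfold fermiOccupation; positivity

theorem fermiOccupation_lt_one (β ε : ℝ) : fermiOccupation β ε < 1 := by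
  have := Real.cosh_pos (β * ε / 2)
  rw [← sub_pos, one_sub_fermiOccupation]; positivity

theorem one_sub_fermiOccupation_mul_exp (β ε : ℝ) :
    (1 - fermiOccupation β ε) * Real.exp (-(β * ε)) = fermiOccupation β ε := by
  rw [one_sub_fermiOccupation, fermiOccupation, div_mul_eq_mul_div, ← Real.exp_add]
  congr 2; ring

/-- The relaxation rate `2 q(ε)² cosh(βε/2)` of a mode of energy `ε`. -/
def modeRate (β : ℝ) (q : ℝ → ℝ) (ε : ℝ) : ℝ := 2 * (q ε ^ 2 * Real.cosh (β * ε / 2))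

theorem modeRate_mul_fermiOccupation (β : ℝ) (q : ℝ → ℝ) (ε : ℝ) :
    modeRate β q ε * fermiOccupation β ε = filterFunction β q ε ^ 2 := by
  have := (Real.cosh_pos (β * ε / 2)).ne'
  rw [modeRate, fermiOccupation, filterFunction, mul_pow, ← Real.exp_nat_mul]
  field_simp
  congr 2; push_cast; ring

theorem modeRate_mul_one_sub_fermiOccupation (β : ℝ) {q : ℝ → ℝ} (hq : ∀ ν, q (-ν) = q ν) (ε : ℝ) :
    modeRate β q ε * (1 - fermiOccupation β ε) = filterFunction β q (-ε) ^ 2 := by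
  have := (Real.cosh_pos (β * ε / 2)).ne'
  rw [modeRate, one_sub_fermiOccupation, filterFunction, hq, mul_pow, ← Real.exp_nat_mul]
  field_simp
  congr 2; push_cast; ring

/-- The sampler decouples into the relaxation of the individual normal modes. -/
theorem freeFermionSampler_eq_sum (β : ℝ) {q : ℝ → ℝ} (hq : ∀ ν, q (-ν) = q ν)
    {M U : Matrix (Fin n) (Fin n) ℝ} (hM : M.IsHermitian) (hU : Uᵀ * U = 1) {e : Fin n → ℝ}
    (hMU : ∀ i k, ∑ j, M i j * U j k = e k * U i k) :
    freeFermionSampler β q M =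
      ∑ k, modeGenerator (fermiOccupation β (e k)) (modeRate β q (e k)) (normalMode U k) := by
  have hU' : U * Uᵀ = 1 := mul_eq_one_comm.mp hU
  have hH := isHermitian_freeHamiltonian hM
  set H := freeHamiltonian M
  set f := filterFunction β q
  have hl : ∀ i, filteredJump f H (fermionicJumps (Sum.inl i)) =
      ∑ k, (U i k : ℂ) • ((f (-e k) : ℂ) • normalMode U k) := by
    intro i
    rw [fermionicJumps, Sum.elim_inl, annihilation_eq_sum_normalMode hU', filteredJump_sum]
    refine Finset.sum_congr rfl fun k _ => ?_
    rw [filteredJump_smul, filteredJump_of_commutator hH (normalMode_commutator hM hMU k)]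
  have hr : ∀ i, filteredJump f H (fermionicJumps (Sum.inr i)) =
      ∑ k, (U i k : ℂ) • ((f (e k) : ℂ) • (normalMode U k)ᴴ) := by
    intro i
    rw [fermionicJumps, Sum.elim_inr, creation_eq_sum_normalMode hU', filteredJump_sum]
    refine Finset.sum_congr rfl fun k _ => ?_
    rw [filteredJump_smul,
      filteredJump_of_commutator hH (normalMode_conjTranspose_commutator hM hMU k)]
  have hl' : ∀ i, (filteredJump f H (fermionicJumps (Sum.inl i)))ᴴ =
      ∑ k, (U i k : ℂ) • ((f (-e k) : ℂ) • (normalMode U k)ᴴ) := by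
    intro i
    simp [hl, Matrix.conjTranspose_sum, Matrix.conjTranspose_smul]
  have hr' : ∀ i, (filteredJump f H (fermionicJumps (Sum.inr i)))ᴴ =
      ∑ k, (U i k : ℂ) • ((f (e k) : ℂ) • normalMode U k) := by
    intro i
    simp [hr, Matrix.conjTranspose_sum, Matrix.conjTranspose_smul]
  set L : Fin n ⊕ Fin n → Matrix (Finset (Fin n)) (Finset (Fin n)) ℂ :=
    fun a => filteredJump f H (fermionicJumps a) with hL
  have hN : ∑ a, (L a)ᴴ * L a = ∑ k, (((f (-e k) ^ 2 : ℝ) : ℂ) •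
      ((normalMode U k)ᴴ * normalMode U k) +
      ((f (e k) ^ 2 : ℝ) : ℂ) • (normalMode U k * (normalMode U k)ᴴ)) := by
    rw [Fintype.sum_sum_type, Finset.sum_add_distrib]
    simp only [hL, hl', hr']
    simp only [hl, hr]
    have h1 := sum_rotated_sandwich hU (fun k => (f (-e k) : ℂ) • (normalMode U k)ᴴ)
      (fun k => (f (-e k) : ℂ) • normalMode U k) 1
    have h2 := sum_rotated_sandwich hU (fun k => (f (e k) : ℂ) • normalMode U k)
      (fun k => (f (e k) : ℂ) • (normalMode U k)ᴴ) 1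
    simp only [mul_one] at h1 h2
    rw [h1, h2]
    simp only [Matrix.smul_mul, Matrix.mul_smul, smul_smul]
    push_cast
    simp only [pow_two]
  -- Frequencies add under products, so `c c†` and `c† c` have frequency zero.
  have hcomm : Commute H (∑ a, (L a)ᴴ * L a) := by
    have key : ∀ A B : Matrix (Finset (Fin n)) (Finset (Fin n)) ℂ, ∀ x : ℝ,
        H * A - A * H = (x : ℂ) • A → H * B - B * H = ((-x : ℝ) : ℂ) • B →
        Commute H (A * B) := by
      intro A B x hA hB
      have h1 : H * (A * B) - A * B * H = (H * A - A * H) * B + A * (H * B - B * H) := by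
        noncomm_ring
      rw [hA, hB, Matrix.smul_mul, Matrix.mul_smul, ← add_smul] at h1
      rw [Commute, SemiconjBy, ← sub_eq_zero, h1]
      simp
    rw [hN]
    refine Commute.sum_right _ _ _ fun k _ => ?_
    have h1 := normalMode_commutator hM hMU k
    have h2 := normalMode_conjTranspose_commutator hM hMU k
    exact ((key _ _ _ h2 h1).smul_right _).add_right
      ((key _ _ _ h1 (by rw [neg_neg]; exact h2)).smul_right _)
  ext1 X
  rw [freeFermionSampler, gibbsSampler, coherentTerm_eq_zero β hH L hcomm, LinearMap.sum_apply]
  change -(Complex.I • (0 * X - X * 0)) + ∑ a, (L a * X * (L a)ᴴ -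
    (1 / 2 : ℂ) • ((L a)ᴴ * L a * X + X * ((L a)ᴴ * L a))) = _
  rw [Finset.sum_sub_distrib, ← Finset.smul_sum, Finset.sum_add_distrib, ← Finset.sum_mul,
    ← Finset.mul_sum, hN, Fintype.sum_sum_type]
  simp only [hL, hl', hr']
  simp only [hl, hr]
  rw [sum_rotated_sandwich hU (fun k => (f (-e k) : ℂ) • normalMode U k)
      (fun k => (f (-e k) : ℂ) • (normalMode U k)ᴴ) X,
    sum_rotated_sandwich hU (fun k => (f (e k) : ℂ) • (normalMode U k)ᴴ)
      (fun k => (f (e k) : ℂ) • normalMode U k) X]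
  rw [zero_mul, mul_zero, sub_zero, smul_zero, neg_zero, zero_add, Finset.sum_mul, Finset.mul_sum,
    ← Finset.sum_add_distrib, ← Finset.sum_add_distrib, Finset.smul_sum, ← Finset.sum_sub_distrib]
  refine Finset.sum_congr rfl fun k _ => ?_
  rw [(isMode_normalMode hU k).modeGenerator_apply, modeRate_mul_fermiOccupation,
    modeRate_mul_one_sub_fermiOccupation β hq]
  simp only [Matrix.smul_mul, Matrix.mul_smul, smul_smul, add_mul, mul_add]
  push_cast
  module

/-! ### The stationary state -/

/-- A state satisfying the detailed balance relations of all normal modes is the Gibbs state. -/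
theorem eq_gibbsState (β : ℝ) {M U : Matrix (Fin n) (Fin n) ℝ} (hM : M.IsHermitian)
    (hU : Uᵀ * U = 1) {e : Fin n → ℝ} (hMU : ∀ i k, ∑ j, M i j * U j k = e k * U i k)
    {Y : Matrix (Finset (Fin n)) (Finset (Fin n)) ℂ} (hY : Y.trace = 1)
    (hfix : ∀ k, reset (fermiOccupation β (e k)) (normalMode U k) Y = Y) :
    Y = gibbsState β (freeHamiltonian M) := by
  have hU' : U * Uᵀ = 1 := mul_eq_one_comm.mp hU
  set H := freeHamiltonian M
  set S := NormedSpace.exp ((β : ℂ) • H) with hS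
  set σ := NormedSpace.exp ((-β : ℂ) • H) with hσ
  have hσS : σ * S = 1 := by
    rw [hσ, hS, ← Matrix.exp_add_of_commute _ _ (((Commute.refl H).smul_left _).smul_right _),
      ← add_smul]
    simp
  -- If `[H, A] = -x A`, then `A e^{βH} = e^{βx} e^{βH} A`.
  have hconj : ∀ (A : Matrix (Finset (Fin n)) (Finset (Fin n)) ℂ) (x : ℝ),
      H * A - A * H = ((-x : ℝ) : ℂ) • A → A * S = (Real.exp (β * x) : ℂ) • (S * A) := by
    intro A x hA
    have h1 : SemiconjBy A ((β : ℂ) • H) ((β : ℂ) • H + ((β * x : ℝ) : ℂ) • 1) := by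
      have h2 : A * H = H * A + (x : ℂ) • A := by
        rw [sub_eq_iff_eq_add] at hA
        rw [hA]; push_cast; module
      rw [SemiconjBy, Matrix.mul_smul, h2, add_mul, Matrix.smul_mul, Matrix.smul_mul, one_mul]
      push_cast
      module
    have h3 : A * S = NormedSpace.exp ((β : ℂ) • H + ((β * x : ℝ) : ℂ) • 1) * A := by
      open scoped Matrix.Norms.L2Operator in
      let _ : NormedAlgebra ℚ (Matrix (Finset (Fin n)) (Finset (Fin n)) ℂ) :=
        NormedAlgebra.restrictScalars ℚ ℂ _
      exact h1.exp_right
    have h4 : NormedSpace.exp (((β * x : ℝ) : ℂ) •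
        (1 : Matrix (Finset (Fin n)) (Finset (Fin n)) ℂ)) = (Real.exp (β * x) : ℂ) • 1 := by
      open scoped Matrix.Norms.L2Operator in
      rw [exp_smul_of_isIdempotentElem IsIdempotentElem.one]
      push_cast
      module
    rw [h3, Matrix.exp_add_of_commute _ _ ((Commute.one_right _).smul_right _), h4,
      Matrix.mul_smul, mul_one, Matrix.smul_mul]
  -- The thermal factors of `e^{βH}` and of `Y` cancel.
  have hmain : ∀ (A : Matrix (Finset (Fin n)) (Finset (Fin n)) ℂ) (x : ℝ), IsMode A →
      H * A - A * H = ((-x : ℝ) : ℂ) • A → reset (fermiOccupation β x) A Y = Y →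
      Commute A (S * Y) := by
    intro A x hA hHA hAY
    have h1 := hA.smul_mul_eq_of_reset_eq hAY
    have hp : ((1 - fermiOccupation β x : ℝ) : ℂ) ≠ 0 := by
      exact_mod_cast (sub_pos.mpr (fermiOccupation_lt_one β x)).ne'
    have h2 : A * Y = (Real.exp (-(β * x)) : ℂ) • (Y * A) := by
      apply smul_right_injective _ hp
      simp only
      rw [h1, smul_smul, ← Complex.ofReal_mul, one_sub_fermiOccupation_mul_exp]
    rw [Commute, SemiconjBy, ← Matrix.mul_assoc, hconj A x hHA, Matrix.smul_mul, Matrix.mul_assoc,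
      h2, Matrix.mul_smul, smul_smul, ← Complex.ofReal_mul, ← Real.exp_add, Matrix.mul_assoc]
    simp
  have hc : ∀ k, Commute (normalMode U k) (S * Y) := fun k =>
    hmain _ _ (isMode_normalMode hU k) (normalMode_commutator hM hMU k) (hfix k)
  have hc' : ∀ k, Commute (normalMode U k)ᴴ (S * Y) := by
    intro k
    refine hmain _ (-e k) (isMode_normalMode hU k).conjTranspose
      (by rw [neg_neg]; exact normalMode_conjTranspose_commutator hM hMU k) ?_
    have : fermiOccupation β (-e k) = 1 - fermiOccupation β (e k) := by
      rw [one_sub_fermiOccupation, fermiOccupation, mul_neg, neg_neg, neg_div, Real.cosh_neg]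
    rw [reset_conjTranspose, this, sub_sub_cancel, hfix k]
  obtain ⟨z, hz⟩ := eq_smul_one_of_commute (X := S * Y)
    (fun i => by
      rw [annihilation_eq_sum_normalMode hU']
      exact Commute.sum_left _ _ _ fun k _ => (hc k).smul_left _)
    (fun i => by
      rw [creation_eq_sum_normalMode hU']
      exact Commute.sum_left _ _ _ fun k _ => (hc' k).smul_left _)
  have hYz : Y = z • σ := by
    have := congrArg (σ * ·) hz
    simpa [← Matrix.mul_assoc, hσS] using this
  rw [gibbsState, ← hσ]
  rw [hYz, Matrix.trace_smul, smul_eq_mul] at hY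
  rw [← eq_inv_of_mul_eq_one_left hY]
  exact hYz

/-- A product of commuting idempotents absorbs each of its factors. -/
theorem mul_list_prod_eq_of_mem {κ R : Type*} [Monoid R] {E : κ → R}
    (hE : ∀ k, E k * E k = E k) (hcomm : ∀ k j, Commute (E k) (E j)) {l : List κ} {k : κ}
    (hk : k ∈ l) : E k * (l.map E).prod = (l.map E).prod := by
  induction l with
  | nil => simp at hk
  | cons j l ih =>
    rw [List.map_cons, List.prod_cons]
    rcases List.mem_cons.mp hk with rfl | hk
    · rw [← mul_assoc, hE]
    · rw [← mul_assoc, (hcomm k j).eq, mul_assoc, ih hk]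

/-! ### The mixing time -/

theorem exists_diagonalization {M : Matrix (Fin n) (Fin n) ℝ} (hM : M.IsHermitian) :
    ∃ U : Matrix (Fin n) (Fin n) ℝ, Uᵀ * U = 1 ∧
      ∀ i k, ∑ j, M i j * U j k = hM.eigenvalues k * U i k := by
  refine ⟨hM.eigenvectorUnitary, ?_, fun i k => ?_⟩
  · have := Unitary.coe_star_mul_self hM.eigenvectorUnitary
    rwa [Matrix.star_eq_conjTranspose, Matrix.conjTranspose_eq_transpose_of_trivial] at this
  · have h := congrFun (hM.mulVec_eigenvectorBasis k) i
    simpa [Matrix.mulVec, dotProduct, Matrix.IsHermitian.eigenvectorUnitary_apply] using h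

theorem freeGap_le_modeRate (β : ℝ) (q : ℝ → ℝ) {M : Matrix (Fin n) (Fin n) ℝ}
    (hM : M.IsHermitian) (k : Fin n) : freeGap β q hM ≤ modeRate β q (hM.eigenvalues k) :=
  mul_le_mul_of_nonneg_left (ciInf_le (Set.finite_range _).bddBelow k) zero_le_two

/-- Exponential convergence to the Gibbs state, with a prefactor linear in the number of modes. -/
theorem traceNorm_evolution_sub_gibbsState_le (β : ℝ) {q : ℝ → ℝ} (hq : ∀ ν, q (-ν) = q ν)
    {M : Matrix (Fin n) (Fin n) ℝ} (hM : M.IsHermitian) (hgap : 0 < freeGap β q hM) {t : ℝ}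
    (ht : 0 ≤ t) {ρ : Matrix (Finset (Fin n)) (Finset (Fin n)) ℂ} (hρ : IsState ρ) :
    traceNorm (evolution (freeFermionSampler β q M) t ρ - gibbsState β (freeHamiltonian M)) ≤
      n * (4 * Real.exp (-(freeGap β q hM * t) / 2)) := by
  obtain ⟨U, hU, hMU⟩ := exists_diagonalization hM
  set e := hM.eigenvalues
  have hc := isMode_normalMode hU
  have hanti : ∀ k j, k ≠ j → normalMode U k * (normalMode U j)ᴴ +
      (normalMode U j)ᴴ * normalMode U k = 0 := fun k j h => by
    rw [normalMode_conjTranspose_anticomm hU, if_neg h]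
  set p := fun k => fermiOccupation β (e k)
  have hp : ∀ k, 0 ≤ p k := fun k => (fermiOccupation_pos β (e k)).le
  have hp' : ∀ k, p k ≤ 1 := fun k => (fermiOccupation_lt_one β (e k)).le
  have hrate : ∀ k, freeGap β q hM ≤ modeRate β q (e k) := freeGap_le_modeRate β q hM
  have hs : ∀ k, Real.exp (-(modeRate β q (e k) * t) / 2) ≤
      Real.exp (-(freeGap β q hM * t) / 2) := by
    intro k
    have := mul_le_mul_of_nonneg_right (hrate k) ht
    exact Real.exp_le_exp.mpr (by linarith)
  have hs1 : ∀ k, Real.exp (-(modeRate β q (e k) * t) / 2) ≤ 1 := by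
    intro k
    have := mul_nonneg (hgap.le.trans (hrate k)) ht
    exact Real.exp_le_one_iff.mpr (by linarith)
  have hY : ((List.finRange n).map fun k => reset (p k) (normalMode U k)).prod ρ =
      gibbsState β (freeHamiltonian M) := by
    refine eq_gibbsState β hM hU hMU (isState_list_prod
      (fun k => (hc k).isPositiveTracePreserving_reset (hp k) (hp' k)) _ hρ).2 fun k => ?_
    have h := mul_list_prod_eq_of_mem (E := fun k => reset (p k) (normalMode U k))
      (fun k => ((hc k).projections (p k)).2.2.2) (fun k j => by
        rcases eq_or_ne k j with rfl | h
        · exact Commute.refl _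
        · exact commute_reset (normalMode_anticomm U k j) (hanti k j h) _ _)
      (List.mem_finRange k)
    rw [← Module.End.mul_apply, h]
  rw [freeFermionSampler_eq_sum β hq hM hU hMU, evolution_sum_modeGenerator hc _ _ (fun k j => by
      rcases eq_or_ne k j with rfl | h
      · exact Commute.refl _
      · exact commute_modeGenerator (normalMode_anticomm U k j) (hanti k j h) _ _ _ _), ← hY]
  have h := traceBounded_prod_sub_prod
    (fun k => (hc k).isPositiveTracePreserving_relax (hp k) (hp' k) (Real.exp_nonneg _) (hs1 k))
    (fun k => (hc k).isPositiveTracePreserving_reset (hp k) (hp' k))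
    (fun k _ hρ' => (hc k).traceBounded_relax_sub_reset (hp k) (hp' k) (Real.exp_nonneg _) (hs1 k)
      (hs k) hρ') (List.finRange n) hρ
  simpa using h.traceNorm_le

/-- At time `(2 / Δ₀) log (8n / ε)` the trace distance is at most `4n · ε / (8n) = ε / 2`. If
`ε > 8n`, the logarithm is negative, and the same bound holds at time `0`. -/
theorem freeFermionMixingTime_le (β : ℝ) {q : ℝ → ℝ} (hq : ∀ ν, q (-ν) = q ν) (hn : 1 ≤ n)
    {M : Matrix (Fin n) (Fin n) ℝ} (hM : M.IsHermitian) (hgap : 0 < freeGap β q hM) {ε : ℝ}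
    (hε : 0 < ε) : freeFermionMixingTime β q M ε ≤
      ENNReal.ofReal (2 / freeGap β q hM * Real.log (8 * n / ε)) := by
  refine iInf₂_le (Real.toNNReal (2 / freeGap β q hM * Real.log (8 * n / ε))) fun ρ hρ => ?_
  refine (traceNorm_evolution_sub_gibbsState_le β hq hM hgap NNReal.zero_le_coe hρ).trans ?_
  have hn' : (0 : ℝ) < n := by exact_mod_cast hn
  have h1 : Real.log (8 * n / ε) ≤ freeGap β q hM *
      (Real.toNNReal (2 / freeGap β q hM * Real.log (8 * n / ε)) : ℝ) / 2 := by
    have := mul_le_mul_of_nonneg_left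
      (Real.le_coe_toNNReal (2 / freeGap β q hM * Real.log (8 * n / ε))) hgap.le
    have h2 : freeGap β q hM * (2 / freeGap β q hM * Real.log (8 * n / ε)) =
        2 * Real.log (8 * n / ε) := by field_simp
    linarith
  have h3 : Real.exp (-(freeGap β q hM *
      (Real.toNNReal (2 / freeGap β q hM * Real.log (8 * n / ε)) : ℝ)) / 2) ≤ ε / (8 * n) := by
    rw [← Real.exp_log (show 0 < ε / (8 * n) by positivity), Real.exp_le_exp,
      ← inv_div (8 * (n : ℝ)), Real.log_inv]
    linarith
  calc (n : ℝ) * (4 * _) ≤ n * (4 * (ε / (8 * n))) := by gcongr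
    _ = ε / 2 := by field_simp; norm_num
    _ ≤ ε := by linarith

theorem abs_eigenvalues_le {M : Matrix (Fin n) (Fin n) ℝ} (hM : M.IsHermitian) (k : Fin n) :
    |hM.eigenvalues k| ≤ ‖Matrix.toEuclideanCLM (𝕜 := ℝ) M‖ := by
  have h : Matrix.toEuclideanCLM (𝕜 := ℝ) M (hM.eigenvectorBasis k) =
      hM.eigenvalues k • hM.eigenvectorBasis k := by
    ext i
    simpa using congrFun (hM.mulVec_eigenvectorBasis k) i
  have h1 := (Matrix.toEuclideanCLM (𝕜 := ℝ) M).le_opNorm (hM.eigenvectorBasis k)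
  rw [h, norm_smul, hM.eigenvectorBasis.orthonormal.1 k] at h1
  simpa using h1

/-- The gap is bounded below over all single-particle Hamiltonians of norm at most `C`. -/
theorem exists_pos_le_freeGap (β : ℝ) (q : ℝ → ℝ) (C : ℝ) (hcont : ContinuousOn q (Set.Icc (-C) C))
    (hne : ∀ ν ∈ Set.Icc (-C) C, q ν ≠ 0) : ∃ κ : ℝ, 0 < κ ∧
      ∀ (n : ℕ) (_ : 1 ≤ n) (M : Matrix (Fin n) (Fin n) ℝ) (hM : M.IsHermitian),
        ‖Matrix.toEuclideanCLM (𝕜 := ℝ) M‖ ≤ C → κ ≤ freeGap β q hM := by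
  -- For `C < 0` there is no matrix to consider, and the interval `[-C, C]` is empty.
  rcases lt_or_ge C 0 with hC | hC
  · exact ⟨1, one_pos, fun n _ M _ h => absurd ((norm_nonneg _).trans h) hC.not_ge⟩
  obtain ⟨x, hx, hmin⟩ := isCompact_Icc.exists_isMinOn (s := Set.Icc (-C) C) ⟨0, by simp [hC]⟩
    (hcont.pow 2)
  refine ⟨2 * q x ^ 2, by have := hne x hx; positivity, fun n hn M hM hMC => ?_⟩
  have : Nonempty (Fin n) := ⟨⟨0, hn⟩⟩
  refine mul_le_mul_of_nonneg_left (le_ciInf fun k => ?_) zero_le_two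
  have h1 : q x ^ 2 ≤ q (hM.eigenvalues k) ^ 2 :=
    hmin (abs_le.mp ((abs_eigenvalues_le hM k).trans hMC))
  nlinarith [Real.one_le_cosh (β * hM.eigenvalues k / 2), sq_nonneg (q (hM.eigenvalues k))]

end NormalModes

end GibbsSampler

end

open GibbsSampler in
theorem mainTheorem4 (β : ℝ) (q : ℝ → ℝ) (hq : ∀ ν, q (-ν) = q ν) :
    (∀ (n : ℕ) (_ : 1 ≤ n) (M : Matrix (Fin n) (Fin n) ℝ) (hM : M.IsHermitian),
      0 < freeGap β q hM → ∀ ε : ℝ, 0 < ε →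
        freeFermionMixingTime β q M ε ≤
          ENNReal.ofReal (2 / freeGap β q hM * Real.log (8 * n / ε))) ∧
    (∀ C : ℝ, ContinuousOn q (Set.Icc (-C) C) → (∀ ν ∈ Set.Icc (-C) C, q ν ≠ 0) →
      ∃ κ : ℝ, 0 < κ ∧
        ∀ (n : ℕ) (_ : 1 ≤ n) (M : Matrix (Fin n) (Fin n) ℝ) (hM : M.IsHermitian),
          ‖Matrix.toEuclideanCLM (𝕜 := ℝ) M‖ ≤ C →
            κ ≤ freeGap β q hM ∧ ∀ ε : ℝ, 0 < ε →
              freeFermionMixingTime β q M ε ≤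
                ENNReal.ofReal (2 / κ * Real.log (8 * n / ε))) := by
  refine ⟨fun n hn M hM hgap ε hε => freeFermionMixingTime_le β hq hn hM hgap hε,
    fun C hcont hne => ?_⟩
  obtain ⟨κ, hκ, h⟩ := exists_pos_le_freeGap β q C hcont hne
  refine ⟨κ, hκ, fun n hn M hM hMC => ⟨h n hn M hM hMC, fun ε hε => ?_⟩⟩
  have hgap := h n hn M hM hMC
  refine (freeFermionMixingTime_le β hq hn hM (hκ.trans_le hgap) hε).trans ?_
  rcases le_total 0 (Real.log (8 * n / ε)) with hlog | hlog
  · exact ENNReal.ofReal_le_ofReal (by gcongr)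
  · -- For `ε ≥ 8n` both sides are `0`, as `ENNReal.ofReal` truncates.
    rw [ENNReal.ofReal_of_nonpos (mul_nonpos_of_nonneg_of_nonpos
      (div_nonneg zero_le_two (hκ.trans_le hgap).le) hlog)]
    exact zero_le
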